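/- Let $m\ge 1$, let $e_1,\dots,e_m$ be the generators of the complexified Clifford algebra $\mathbb{C}\otimes \mathcal{C}\ell_{0,m}$ ($e_je_k+e_ke_j=-2\delta_{jk}$), and identify $x\in\mathbb{R}^m$ with $\sum_j e_jx_j$. Let $(x,y)$ be the Euclidean inner product and $$\Gamma_y=-\sum_{j<k}e_je_k\,(y_j\partial_{y_k}-y_k\partial_{y_j}).$$ For $G\in\mathbb{Z}[X]$ the operator $e^{i\frac{\pi}{2}G(\Gamma_y)}$ is defined by the exponential series $\sum_n \frac{1}{n!}\left(i\frac{\pi}{2}G(\Gamma_y)\right)^n$ on Clifford-algebra-valued homogeneous polynomials in $y$ (each finite-dimensional space of homogeneous polynomials of fixed degree is preserved by $\Gamma_y$), and is applied to $y\mapsto e^{-it(x,y)}$ by acting on each homogeneous component of its Taylor series at $y=0$ and summing. Let $G\in\mathbb{Z}[X]$ and $x,y\in\mathbb{R}^m$. For every $t\in\mathbb{R}$ the series defining $e^{i\frac{\pi}{2}G(\Gamma_y)}e^{-it(x,y)}$ converge, and for every $s\in\mathbb{C}$ with $\operatorname{Re}s>0$ the function $t\mapsto e^{-st}\,t^{m/2-1}e^{i\frac{\pi}{2}G(\Gamma_y)}e^{-it(x,y)}$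 is integrable on $(0,\infty)$, with $$\int_0^\infty e^{-st}\,t^{m/2-1}e^{i\frac{\pi}{2}G(\Gamma_y)}e^{-it(x,y)}\,dt=\frac{\Gamma(m/2)}{8}\left(A^1_m B\,C_m^{T}+\frac{iy}{s+\sqrt{+}}\,A^2_m B\,C_m^{T}\,x\right).$$ Here $\sqrt{+}=\sqrt{s^2+|x|^2|y|^2}$, all roots and powers are principal branches, $$A^1_m=\begin{pmatrix}i^{G(0)}&i^{G(-1)}&i^{G(-2)}&i^{G(-3)}\end{pmatrix},\qquad A^2_m=\begin{pmatrix}i^{G(m-1)}&i^{G(m)}&i^{G(m+1)}&i^{G(m+2)}\end{pmatrix},$$ $$B=\begin{pmatrix}1&1&1&1\\1&-i&-1&i\\1&-1&1&-1\\1&i&-1&-i\end{pmatrix},\qquad C_m=\begin{pmatrix}f&f_\alpha&f_\beta&f_\gamma\end{pmatrix},$$ where, with Clifford products $yx$, $$f=\frac{s+\sqrt{+}-iyx}{\sqrt{+}\,(s+i(x,y))^{m/2}},\qquad f_\alpha=\frac{s+\sqrt{+}+yx}{\sqrt{+}\,(\sqrt{+}-(x,y))^{m/2}},$$ $$f_\beta=\frac{s+\sqrt{+}+iyx}{\sqrt{+}\,(s-i(x,y))^{m/2}},\qquad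 f_\gamma=\frac{s+\sqrt{+}-yx}{\sqrt{+}\,(\sqrt{+}+(x,y))^{m/2}}.$$ -/

import Mathlib

open scoped TensorProduct Nat

noncomputable section

namespace CliffordFourier

/-- Euclidean space `ℝ^m` with its usual inner product and norm. -/
abbrev RVec (m : ℕ) : Type := EuclideanSpace ℝ (Fin m)

/-- The quadratic form `v ↦ -|v|²` on `ℝ^m`. -/
def negNormSq (m : ℕ) : QuadraticForm ℝ (RVec m) :=
  -(LinearMap.BilinMap.toQuadraticMap (innerₗ (RVec m)))

/-- The complexified Clifford algebra `ℂ ⊗ Cl_{0,m}`, with `e_i e_j + e_j e_i = -2 δ_{ij}`. -/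
def CCl (m : ℕ) : Type := ℂ ⊗[ℝ] CliffordAlgebra (negNormSq m)

instance (m : ℕ) : Ring (CCl m) :=
  inferInstanceAs (Ring (ℂ ⊗[ℝ] CliffordAlgebra (negNormSq m)))

instance (m : ℕ) : Algebra ℂ (CCl m) :=
  inferInstanceAs (Algebra ℂ (ℂ ⊗[ℝ] CliffordAlgebra (negNormSq m)))

/-- The basis `e_A`, `A ⊆ {1, …, m}`, transported from the exterior algebra. -/
def cclBasis (m : ℕ) : Module.Basis (Finset (Fin m)) ℂ (CCl m) :=
  (((EuclideanSpace.basisFun (Fin m) ℝ).toBasis.ExteriorAlgebra).map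
    (CliffordAlgebra.equivExterior (negNormSq m)).symm).baseChange ℂ

/-- Coordinates in the basis `e_A`. -/
def cclCoord (m : ℕ) : CCl m ≃ₗ[ℂ] EuclideanSpace ℂ (Finset (Fin m)) :=
  (cclBasis m).equivFun.trans (WithLp.linearEquiv 2 ℂ (Finset (Fin m) → ℂ)).symm

/-- The norm `|a|² = ∑_A |a_A|²`; it only serves to fix the (unique) topology of this
finite-dimensional space, in which derivatives, sums and integrals are taken. -/
instance (m : ℕ) : NormedAddCommGroup (CCl m) :=
  NormedAddCommGroup.induced (CCl m) (EuclideanSpace ℂ (Finset (Fin m)))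
    (cclCoord m).toLinearMap (cclCoord m).injective

instance (m : ℕ) : NormedSpace ℂ (CCl m) :=
  NormedSpace.induced ℂ (CCl m) (EuclideanSpace ℂ (Finset (Fin m))) (cclCoord m).toLinearMap

variable {m : ℕ}

/-- The identification of a point `x ∈ ℝ^m` with the Clifford vector `∑_j e_j x_j`. -/
def vec (x : RVec m) : CCl m :=
  (1 : ℂ) ⊗ₜ[ℝ] CliffordAlgebra.ι (negNormSq m) x

/-- The generator `e_j`. -/
def e (j : Fin m) : CCl m := vec (EuclideanSpace.single j 1)

/-- The partial derivative `∂F/∂y_j`. -/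
def partialD (j : Fin m) (F : RVec m → CCl m) (y : RVec m) : CCl m :=
  fderiv ℝ F y (EuclideanSpace.single j 1)

/-- The angular Dirac operator `Γ_y = -∑_{j<k} e_j e_k (y_j ∂_{y_k} - y_k ∂_{y_j})`. -/
def angularDirac (F : RVec m → CCl m) : RVec m → CCl m := fun y =>
  -∑ j : Fin m, ∑ k ∈ Finset.Ioi j,
    e j * e k * ((y j : ℂ) • partialD k F y - (y k : ℂ) • partialD j F y)

/-- The operator `G(Γ_y) = ∑_n a_n Γ_y^n` for `G = ∑_n a_n X^n`. -/
def polyAngularDirac (G : Polynomial ℤ) (F : RVec m → CCl m) : RVec m → CCl m :=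
  G.sum fun n a => (a : ℂ) • (angularDirac^[n] F)

/-- The homogeneous component of degree `k` of the Taylor expansion of `F` at the origin. -/
def homPart (k : ℕ) (F : RVec m → CCl m) : RVec m → CCl m := fun y =>
  ((k ! : ℂ))⁻¹ • iteratedDeriv k (fun r : ℝ => F (r • y)) 0

/-- The `n`-th term `(1/n!) (i(π/2) G(Γ_y))^n P` of the operator exponential. -/
def expTerm (G : Polynomial ℤ) (n : ℕ) (P : RVec m → CCl m) : RVec m → CCl m := fun y =>
  ((Complex.I * (Real.pi : ℂ) / 2) ^ n / (n ! : ℂ)) • ((polyAngularDirac G)^[n] P) y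

/-- `e^{i(π/2) G(Γ_y)} P = ∑_n (1/n!) (i(π/2) G(Γ_y))^n P`, for homogeneous polynomials `P`. The
homogeneous polynomials of a given degree form a finite-dimensional space preserved by `Γ_y`. -/
def expHom (G : Polynomial ℤ) (P : RVec m → CCl m) : RVec m → CCl m := fun y =>
  ∑' n : ℕ, expTerm G n P y

/-- `e^{i(π/2) G(Γ_y)} F` for an entire function `F`: the operator exponential acts on each
homogeneous component of `F`, and the results are summed. (For `deg G ≥ 2` the exponential
series itself need not converge on non-polynomial functions.) -/
def expAngular (G : Polynomial ℤ) (F : RVec m → CCl m) : RVec m → CCl m := fun y =>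
  ∑' k : ℕ, expHom G (homPart k F) y

/-- The function `y ↦ e^{-it(x,y)}`. -/
def planeWave (t : ℝ) (x : RVec m) : RVec m → CCl m := fun y =>
  Complex.exp (-Complex.I * (t : ℂ) * ((inner ℝ x y : ℝ) : ℂ)) • (1 : CCl m)

/-- `√+ = √(s² + |x|²|y|²)`, principal branch. -/
def sqrtPlus (s : ℂ) (x y : RVec m) : ℂ :=
  (s ^ 2 + ((‖x‖ ^ 2 * ‖y‖ ^ 2 : ℝ) : ℂ)) ^ (1 / 2 : ℂ)

/-- `f = (s + √+ - i y x) / (√+ (s + i(x,y))^{m/2})`. -/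
def f (s : ℂ) (x y : RVec m) : CCl m :=
  (sqrtPlus s x y * (s + Complex.I * ((inner ℝ x y : ℝ) : ℂ)) ^ ((m : ℂ) / 2))⁻¹ •
    ((s + sqrtPlus s x y) • (1 : CCl m) - Complex.I • (vec y * vec x))

/-- `f_α = (s + √+ + y x) / (√+ (√+ - (x,y))^{m/2})`. -/
def fα (s : ℂ) (x y : RVec m) : CCl m :=
  (sqrtPlus s x y * (sqrtPlus s x y - ((inner ℝ x y : ℝ) : ℂ)) ^ ((m : ℂ) / 2))⁻¹ •
    ((s + sqrtPlus s x y) • (1 : CCl m) + vec y * vec x)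

/-- `f_β = (s + √+ + i y x) / (√+ (s - i(x,y))^{m/2})`. -/
def fβ (s : ℂ) (x y : RVec m) : CCl m :=
  (sqrtPlus s x y * (s - Complex.I * ((inner ℝ x y : ℝ) : ℂ)) ^ ((m : ℂ) / 2))⁻¹ •
    ((s + sqrtPlus s x y) • (1 : CCl m) + Complex.I • (vec y * vec x))

/-- `f_γ = (s + √+ - y x) / (√+ (√+ + (x,y))^{m/2})`. -/
def fγ (s : ℂ) (x y : RVec m) : CCl m :=
  (sqrtPlus s x y * (sqrtPlus s x y + ((inner ℝ x y : ℝ) : ℂ)) ^ ((m : ℂ) / 2))⁻¹ •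
    ((s + sqrtPlus s x y) • (1 : CCl m) - vec y * vec x)

/-- The row `C_m = (f, f_α, f_β, f_γ)`. -/
def C (s : ℂ) (x y : RVec m) : Fin 4 → CCl m :=
  ![f s x y, fα s x y, fβ s x y, fγ s x y]

/-- The row `A¹ = (i^{G(0)}, i^{G(-1)}, i^{G(-2)}, i^{G(-3)})`. -/
def A₁ (G : Polynomial ℤ) : Fin 4 → ℂ :=
  ![Complex.I ^ G.eval 0, Complex.I ^ G.eval (-1), Complex.I ^ G.eval (-2),
    Complex.I ^ G.eval (-3)]

/-- The row `A²_m = (i^{G(m-1)}, i^{G(m)}, i^{G(m+1)}, i^{G(m+2)})`. -/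
def A₂ (m : ℕ) (G : Polynomial ℤ) : Fin 4 → ℂ :=
  ![Complex.I ^ G.eval ((m : ℤ) - 1), Complex.I ^ G.eval (m : ℤ),
    Complex.I ^ G.eval ((m : ℤ) + 1), Complex.I ^ G.eval ((m : ℤ) + 2)]

/-- The `4 × 4` discrete Fourier matrix. -/
def B : Matrix (Fin 4) (Fin 4) ℂ :=
  !![1, 1, 1, 1;
     1, -Complex.I, -1, Complex.I;
     1, -1, 1, -1;
     1, Complex.I, -1, -Complex.I]

/-- The product `A B Cᵀ` of a scalar row `A`, the matrix `B` and a column of Clifford numbers. -/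
def ABC (A : Fin 4 → ℂ) (c : Fin 4 → CCl m) : CCl m :=
  ∑ j : Fin 4, (Matrix.vecMul A B) j • c j

end CliffordFourier

end

namespace CliffordFourier

/-! Put `μ = m/2`, `w = (x,y)`, `q = |x|²|y|²`, `S = √+`, `σ = (s + S)/2`. The zonal monogenics `C_k
+ C_{k-1} yx` and the conjugates `y (C_{k-1} + C_{k-2} yx) x`, built from Gegenbauer polynomials of
order `μ`, are eigenfunctions of `Γ_y` with eigenvalues `-k` and `k + m - 2`, also after
multiplication by powers of `|y|²`. Their difference `C_k - q C_{k-2}` has no `yx` part, and `w^n`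
is a combination of such differences (`pow_eq_sum_gegen_sub`). Each Taylor component of the plane
wave is therefore a finite sum of eigenfunctions, on which the exponential acts by `i^{G(-k)}` and
`i^{G(k+m-2)}`. Summing over the powers of `q` leaves a series in `k` of Bessel functions `bes μ q k
t`.

The Laplace transforms `λ_k` of `t^{μ-1} bes μ q k t` satisfy `s λ_{k+1} = λ_k - (q/4) λ_{k+2}`. The
growth bound `exists_bes_bound` excludes the dominant solution of this recurrence, so `λ_k = λ_0
σ^{-k}` (`lapBes_eq`). The constant `λ_0` is found without a Bessel integral, by applying the method
to a constant function (`lapBes_zero`).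

Since `a - b` divides `G(a) - G(b)`, the multipliers have period 4 in `k`. Fourier analysis on
`ℤ/4`, which is the matrix `B`, writes them through the characters `i^{lk}`. The Gegenbauer
generating function (`hasSum_gegen`) at `i^l (-i/(s+S))` then equals `(p_l/σ)^{-μ}`, where `p_l`
runs through `s ± iw` and `S ± w`. Lemma `div_cpow_of_arg` splits this quotient on the principal
branch, and the powers of `σ` cancel against `λ_0`. -/

/-! ### Gegenbauer polynomials and their derivatives. -/

/-- Gegenbauer polynomials of order `μ`, homogenized by `q` and shifted by one:
`gegen μ w q (k + 1) = q^{k/2} C_k^μ(w / √q)`. -/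
noncomputable def gegen (μ w q : ℝ) : ℕ → ℝ
  | 0 => 0
  | 1 => 1
  | k + 2 => (2 * (k + μ) * w * gegen μ w q (k + 1) - (k + 2 * μ - 1) * q * gegen μ w q k) / (k + 1)

/-- The derivative of `gegen μ w q k` in `w`. -/
noncomputable def gegenD (μ w q : ℝ) : ℕ → ℝ
  | 0 => 0
  | 1 => 0
  | k + 2 => (2 * (k + μ) * (gegen μ w q (k + 1) + w * gegenD μ w q (k + 1)) -
      (k + 2 * μ - 1) * q * gegenD μ w q k) / (k + 1)

section gegen

variable (μ w q : ℝ)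

@[simp] lemma gegen_zero : gegen μ w q 0 = 0 := by simp [gegen]

@[simp] lemma gegen_one : gegen μ w q 1 = 1 := by simp [gegen]

lemma gegen_rec (k : ℕ) : (k + 1) * gegen μ w q (k + 2) =
    2 * (k + μ) * w * gegen μ w q (k + 1) - (k + 2 * μ - 1) * q * gegen μ w q k := by
  have : (k : ℝ) + 1 ≠ 0 := by positivity
  rw [gegen]; field_simp

lemma gegenD_rec (k : ℕ) : (k + 1) * gegenD μ w q (k + 2) =
    2 * (k + μ) * (gegen μ w q (k + 1) + w * gegenD μ w q (k + 1)) -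
      (k + 2 * μ - 1) * q * gegenD μ w q k := by
  have : (k : ℝ) + 1 ≠ 0 := by positivity
  rw [gegenD]; field_simp

/-- The two relations are proved together because the induction step for the second needs both. They
are exactly the eigenvalue equations of the zonal functions below. -/
lemma gegenD_identities (k : ℕ) :
    gegenD μ w q (k + 1) = w * gegenD μ w q k + (k - 1 + 2 * μ) * gegen μ w q k ∧
    w * gegenD μ w q (k + 1) - q * gegenD μ w q k = k * gegen μ w q (k + 1) := by
  induction k with
  | zero => simp [gegenD]
  | succ k ih =>
    obtain ⟨h1, h2⟩ := ih
    have hk : (k : ℝ) + 1 ≠ 0 := by positivity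
    have hD := gegenD_rec μ w q k
    have hG := gegen_rec μ w q k
    have h3 : gegenD μ w q (k + 2) =
        w * gegenD μ w q (k + 1) + (k + 2 * μ) * gegen μ w q (k + 1) := by
      apply mul_left_cancel₀ hk
      rw [hD]
      linear_combination (k + 2 * μ - 1) * h2
    refine ⟨by push_cast; rw [h3]; ring, ?_⟩
    push_cast
    rw [hG, h3]
    linear_combination w * h2 - q * h1

end gegen

/-! ### Powers of the inner product as sums of Gegenbauer polynomials. -/

/-- The pairs `(k, j)` with `k + 2 j = n`. -/
def weightPairs (n : ℕ) : Finset (ℕ × ℕ) :=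
  (Finset.range (n + 1) ×ˢ Finset.range (n + 1)).filter fun p => p.1 + 2 * p.2 = n

lemma mem_weightPairs {n : ℕ} {p : ℕ × ℕ} : p ∈ weightPairs n ↔ p.1 + 2 * p.2 = n := by
  simp only [weightPairs, Finset.mem_filter, Finset.mem_product, Finset.mem_range]
  omega

/-- Reindexing along `(k + a, j) ↦ (k + c, j + b)`. Terms without a partner vanish by hypothesis, so
no boundary terms arise. -/
lemma sum_weightPairs_shift {n n' a b : ℕ} (c : ℕ) (hn : n' + a = n + c + 2 * b) (F H : ℕ → ℕ → ℝ)
    (hFH : ∀ k j, F (k + a) j = H (k + c) (j + b))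
    (hF : ∀ k < a, ∀ j, F k j = 0) (hH : ∀ k j, k < c ∨ j < b → H k j = 0) :
    ∑ p ∈ weightPairs n, F p.1 p.2 = ∑ p ∈ weightPairs n', H p.1 p.2 := by
  refine Finset.sum_bij_ne_zero (fun p _ _ => (p.1 - a + c, p.2 + b)) ?_ ?_ ?_ ?_
  · rintro ⟨k, j⟩ hp h0
    have hk : a ≤ k := by by_contra! h; exact h0 (hF k h j)
    rw [mem_weightPairs] at hp ⊢
    dsimp only at hp ⊢
    omega
  · rintro ⟨k, j⟩ hp h0 ⟨k', j'⟩ hp' h0' h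
    have hk : a ≤ k := by by_contra! h; exact h0 (hF k h j)
    have hk' : a ≤ k' := by by_contra! h; exact h0' (hF k' h j')
    simp only [Prod.mk.injEq] at h ⊢
    omega
  · rintro ⟨k, j⟩ hp h0
    have hk : ¬ (k < c ∨ j < b) := fun h => h0 (hH k j h)
    rw [mem_weightPairs] at hp
    dsimp only at hp h0
    have e := hFH (k - c) (j - b)
    rw [show k - c + c = k by omega, show j - b + b = j by omega] at e
    refine ⟨(k - c + a, j - b), ?_, ?_, ?_⟩
    · rw [mem_weightPairs]; dsimp only; omega
    · dsimp only; rw [e]; exact h0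
    · simp only [Prod.mk.injEq]; omega
  · rintro ⟨k, j⟩ hp h0
    have hk : a ≤ k := by by_contra! h; exact h0 (hF k h j)
    have e := hFH (k - a) j
    rw [show k - a + a = k by omega] at e
    exact e

/-- The coefficient `q^j / (j! Γ(k + j + μ))`. -/
noncomputable def besselCoeff (μ q : ℝ) (k j : ℕ) : ℝ :=
  q ^ j / (j ! * Real.Gamma (k + j + μ))

/-- Multiplying by `2w` and using the three-term recurrence moves the term at `(k, j)` to `(k + 1,
j)` and `(k - 1, j + 1)`. The coefficients match because `k(k+j+μ) + j(k+2μ) = (k+2j)(k+μ)`. -/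
lemma pow_eq_sum_gegen {μ : ℝ} (hμ : 0 < μ) (w q : ℝ) (n : ℕ) :
    (2 * w) ^ n / n ! = Real.Gamma μ * ∑ p ∈ weightPairs n,
      besselCoeff μ q (p.1 + 1) p.2 * (p.1 + μ) * gegen μ w q (p.1 + 1) := by
  induction n with
  | zero =>
    have : weightPairs 0 = {(0, 0)} := by decide
    have h := (Real.Gamma_pos_of_pos hμ).ne'
    simp [this, besselCoeff, add_comm (1 : ℝ) μ, Real.Gamma_add_one hμ.ne']
    field_simp
  | succ n ih =>
    have hG : ∀ k j : ℕ, Real.Gamma (k + j + 1 + μ) = (k + j + μ) * Real.Gamma (k + j + μ) := by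
      intro k j
      rw [← Real.Gamma_add_one (by positivity)]; ring_nf
    have hGp : ∀ k j : ℕ, Real.Gamma (k + j + μ) ≠ 0 := fun k j =>
      (Real.Gamma_pos_of_pos (by positivity)).ne'
    have key : ∑ p ∈ weightPairs n, besselCoeff μ q (p.1 + 1) p.2 *
        (2 * (p.1 + μ) * w * gegen μ w q (p.1 + 1)) =
        (n + 1) * ∑ p ∈ weightPairs (n + 1), besselCoeff μ q (p.1 + 1) p.2 *
          (p.1 + μ) * gegen μ w q (p.1 + 1) := by
      have e1 : ∑ p ∈ weightPairs n, besselCoeff μ q (p.1 + 1) p.2 *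
          ((p.1 + 1) * gegen μ w q (p.1 + 2)) =
          ∑ p ∈ weightPairs (n + 1), besselCoeff μ q p.1 p.2 * (p.1 * gegen μ w q (p.1 + 1)) :=
        sum_weightPairs_shift (a := 0) (b := 0) 1 (by omega)
          (fun k j => besselCoeff μ q (k + 1) j * ((k + 1) * gegen μ w q (k + 2)))
          (fun k j => besselCoeff μ q k j * (k * gegen μ w q (k + 1)))
          (fun k j => by push_cast; simp only [add_zero]) (by simp) (by intro k j h; obtain rfl : k = 0 := (by omega); simp)
      have e2 : ∑ p ∈ weightPairs n, besselCoeff μ q (p.1 + 1) p.2 *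
          ((p.1 + 2 * μ - 1) * q * gegen μ w q p.1) =
          ∑ p ∈ weightPairs (n + 1), besselCoeff μ q (p.1 + 1) p.2 * (p.2 * (p.1 + 2 * μ) *
            gegen μ w q (p.1 + 1)) := by
        refine sum_weightPairs_shift (a := 1) (b := 1) 0 (by omega)
          (fun k j => besselCoeff μ q (k + 1) j * ((k + 2 * μ - 1) * q * gegen μ w q k))
          (fun k j => besselCoeff μ q (k + 1) j * (j * (k + 2 * μ) * gegen μ w q (k + 1)))
          ?_ ?_ ?_
        · intro k j
          have : (j : ℝ) + 1 ≠ 0 := by positivity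
          have := hGp (k + 2) j
          simp only [besselCoeff, Nat.factorial_succ, add_zero]
          push_cast at this ⊢
          rw [show (k : ℝ) + 1 + 1 + j + μ = k + 2 + j + μ by ring,
            show (k : ℝ) + 1 + (j + 1) + μ = k + 2 + j + μ by ring]
          field_simp
          ring
        · intro k hk j; obtain rfl : k = 0 := by omega
          simp
        · intro k j h; obtain rfl : j = 0 := by omega
          simp
      have e0 : ∀ p : ℕ × ℕ, besselCoeff μ q (p.1 + 1) p.2 *
        (2 * (p.1 + μ) * w * gegen μ w q (p.1 + 1)) = besselCoeff μ q (p.1 + 1) p.2 *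
          ((p.1 + 1) * gegen μ w q (p.1 + 2)) + besselCoeff μ q (p.1 + 1) p.2 *
          ((p.1 + 2 * μ - 1) * q * gegen μ w q p.1) := by
        intro p
        rw [gegen_rec]; ring
      rw [Finset.sum_congr rfl fun p _ => e0 p, Finset.sum_add_distrib, e1, e2,
        ← Finset.sum_add_distrib, Finset.mul_sum]
      refine Finset.sum_congr rfl ?_
      rintro ⟨k, j⟩ hp
      rw [mem_weightPairs] at hp
      dsimp only at hp ⊢
      have hn : (n : ℝ) + 1 = k + 2 * j := by exact_mod_cast hp.symm
      have h1 := hGp k j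
      have h2 : (k : ℝ) + j + μ ≠ 0 := by positivity
      simp only [besselCoeff]
      push_cast
      rw [hn, show (k : ℝ) + 1 + j + μ = k + j + 1 + μ by ring, hG]
      field_simp
      ring
    have hn : (n : ℝ) + 1 ≠ 0 := by positivity
    apply mul_left_cancel₀ hn
    rw [mul_left_comm, ← key]
    have : (n + 1 : ℝ) * ((2 * w) ^ (n + 1) / (n + 1)!) = 2 * w * ((2 * w) ^ n / n !) := by
      rw [Nat.factorial_succ]; push_cast; field_simp; ring
    rw [this, ih, ← mul_assoc, mul_comm (2 * w), mul_assoc, Finset.mul_sum]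
    congr 1
    exact Finset.sum_congr rfl fun p _ => by ring

/-- Moving `q C_{k-2}` to the index `(k - 2, j + 1)` produces a factor `j`, and `(k+j+μ) - j = k+μ`
gives back the previous expansion. -/
lemma pow_eq_sum_gegen_sub {μ : ℝ} (hμ : 0 < μ) (w q : ℝ) (n : ℕ) :
    (2 * w) ^ n / n ! = Real.Gamma μ * ∑ p ∈ weightPairs n,
      besselCoeff μ q p.1 p.2 * (gegen μ w q (p.1 + 1) - q * gegen μ w q (p.1 - 1)) := by
  have hG : ∀ k j : ℕ, Real.Gamma (k + j + 1 + μ) = (k + j + μ) * Real.Gamma (k + j + μ) := by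
    intro k j
    rw [← Real.Gamma_add_one (by positivity)]; ring_nf
  have hGp : ∀ k j : ℕ, Real.Gamma (k + j + μ) ≠ 0 := fun k j =>
    (Real.Gamma_pos_of_pos (by positivity)).ne'
  have e1 : ∑ p ∈ weightPairs n, besselCoeff μ q p.1 p.2 * (q * gegen μ w q (p.1 - 1)) =
      ∑ p ∈ weightPairs n, besselCoeff μ q (p.1 + 1) p.2 * (p.2 * gegen μ w q (p.1 + 1)) := by
    refine sum_weightPairs_shift (a := 2) (b := 1) 0 (by omega)
      (fun k j => besselCoeff μ q k j * (q * gegen μ w q (k - 1)))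
      (fun k j => besselCoeff μ q (k + 1) j * (j * gegen μ w q (k + 1))) ?_ ?_ ?_
    · intro k j
      have : (j : ℝ) + 1 ≠ 0 := by positivity
      have := hGp (k + 2) j
      simp only [besselCoeff, Nat.factorial_succ, add_zero]
      push_cast at this ⊢
      rw [show (k : ℝ) + 1 + (j + 1) + μ = k + 2 + j + μ by ring]
      field_simp
      ring
    · intro k hk j
      -- For `k < 2` truncated subtraction gives index `0`, where `gegen` vanishes, in agreement
      -- with `C_{-2} = C_{-1} = 0`.
      have : k - 1 = 0 := by omega
      simp [this]
    · intro k j h; obtain rfl : j = 0 := by omega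
      simp
  rw [pow_eq_sum_gegen hμ w q]
  simp only [mul_sub]
  rw [Finset.sum_sub_distrib, e1, mul_sub, ← mul_sub, ← Finset.sum_sub_distrib]
  congr 1
  refine Finset.sum_congr rfl ?_
  rintro ⟨k, j⟩ -
  have h1 := hGp k j
  have h2 : (k : ℝ) + j + μ ≠ 0 := by positivity
  simp only [besselCoeff]
  push_cast
  rw [show (k : ℝ) + 1 + j + μ = k + j + 1 + μ by ring, hG]
  field_simp
  ring

/-! ### Clifford vectors and the sums occurring in the angular Dirac operator. -/

variable {m : ℕ}

lemma vec_add (x y : RVec m) : vec (x + y) = vec x + vec y := by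
  simp only [vec, map_add, TensorProduct.tmul_add]; rfl

lemma vec_smul (r : ℝ) (x : RVec m) : vec (r • x) = (r : ℂ) • vec x := by
  simp only [vec, map_smul]
  rw [← TensorProduct.smul_tmul]
  change _ = (r : ℂ) • ((1 : ℂ) ⊗ₜ[ℝ] CliffordAlgebra.ι (negNormSq m) x)
  rw [TensorProduct.smul_tmul']
  simp

lemma negNormSq_apply (x : RVec m) : negNormSq m x = -(inner ℝ x x) := by
  simp [negNormSq]

lemma vec_mul_vec_add_swap (x y : RVec m) :
    vec x * vec y + vec y * vec x = (-2 * inner ℝ x y : ℂ) • (1 : CCl m) := by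
  have h := CliffordAlgebra.ι_mul_ι_add_swap (Q := negNormSq m) x y
  have hp : QuadraticMap.polar (negNormSq m) x y = -2 * inner ℝ x y := by
    simp only [QuadraticMap.polar, negNormSq_apply]
    rw [inner_add_left, inner_add_right, inner_add_right, real_inner_comm x y]; ring
  rw [hp] at h
  change ((1 : ℂ) ⊗ₜ[ℝ] CliffordAlgebra.ι (negNormSq m) x) * ((1 : ℂ) ⊗ₜ[ℝ] CliffordAlgebra.ι (negNormSq m) y) + ((1 : ℂ) ⊗ₜ[ℝ] CliffordAlgebra.ι (negNormSq m) y) * ((1 : ℂ) ⊗ₜ[ℝ] CliffordAlgebra.ι (negNormSq m) x) = (-2 * inner ℝ x y : ℂ) • ((1 : ℂ) ⊗ₜ[ℝ] (1 : CliffordAlgebra (negNormSq m)))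
  rw [Algebra.TensorProduct.tmul_mul_tmul, Algebra.TensorProduct.tmul_mul_tmul, mul_one,
    ← TensorProduct.tmul_add, h, Algebra.algebraMap_eq_smul_one, ← TensorProduct.smul_tmul,
    TensorProduct.smul_tmul']
  simp

lemma vec_mul_self (x : RVec m) : vec x * vec x = (-(inner ℝ x x : ℝ) : ℂ) • (1 : CCl m) := by
  have h := vec_mul_vec_add_swap x x
  rw [← two_smul ℂ] at h
  apply smul_right_injective (CCl m) (two_ne_zero (α := ℂ))
  dsimp only
  rw [h, smul_smul]; congr 1; ring

/-- `y ↦ vec y` as a linear map. -/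
noncomputable def vecₗ (m : ℕ) : RVec m →ₗ[ℝ] CCl m where
  toFun := vec
  map_add' := vec_add
  map_smul' r x := by rw [vec_smul]; rfl

/-- `y ↦ vec y * a` as a continuous linear map. -/
noncomputable def vecMulRight (a : CCl m) : RVec m →L[ℝ] CCl m :=
  LinearMap.toContinuousLinearMap
    { toFun := fun y => vec y * a
      map_add' := fun x y => by rw [vec_add, add_mul]
      map_smul' := fun r x => by rw [vec_smul, smul_mul_assoc]; rfl }

@[simp] lemma vecMulRight_apply (a : CCl m) (y : RVec m) : vecMulRight a y = vec y * a := rfl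

lemma vec_eq_sum (x : RVec m) : vec x = ∑ j, (x j : ℂ) • e j := by
  have h : x = ∑ j, x j • EuclideanSpace.single j (1 : ℝ) := by
    ext i; simp [Finset.sum_apply, Pi.single_apply]
  conv_lhs => rw [h]
  change vecₗ m _ = _
  rw [map_sum]
  exact Finset.sum_congr rfl fun j _ => vec_smul _ _

lemma e_mul_self (j : Fin m) : e j * e j = -(1 : CCl m) := by
  rw [e, vec_mul_self]; simp

lemma e_mul_e_swap {j k : Fin m} (h : j ≠ k) : e k * e j = -(e j * e k : CCl m) := by
  rw [eq_neg_iff_add_eq_zero, e, e, vec_mul_vec_add_swap]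
  simp [EuclideanSpace.inner_single_left, h]

lemma sum_Ioi_symm {M : Type*} [AddCommGroup M] (F : Fin m → Fin m → M) :
    ∑ j, ∑ k, F j k = ∑ j, F j j + ∑ j, ∑ k ∈ Finset.Ioi j, (F j k + F k j) := by
  have h1 : ∀ j, ∑ k, F j k = F j j + ∑ k ∈ Finset.Ioi j, F j k + ∑ k ∈ Finset.Iio j, F j k := by
    intro j
    have : (Finset.univ : Finset (Fin m)) = ({j} ∪ Finset.Ioi j) ∪ Finset.Iio j := by
      ext k
      simp only [Finset.mem_univ, Finset.mem_union, Finset.mem_singleton, Finset.mem_Ioi,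
        Finset.mem_Iio, true_iff]
      rcases lt_trichotomy k j with h | h | h <;> simp [h]
    rw [this, Finset.sum_union, Finset.sum_union, Finset.sum_singleton]
    · simp
    · rw [Finset.disjoint_left]; intro k hk hk'
      simp only [Finset.mem_union, Finset.mem_singleton, Finset.mem_Ioi, Finset.mem_Iio] at hk hk'
      rcases hk with rfl | hk
      · exact lt_irrefl _ hk'
      · exact lt_asymm hk hk'
  have h2 : ∑ j, ∑ k ∈ Finset.Iio j, F j k = ∑ j, ∑ k ∈ Finset.Ioi j, F k j :=
    Finset.sum_comm' (by simp)
  simp only [h1, Finset.sum_add_distrib, h2, add_assoc]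

/-- In the double sum for `yx` the diagonal contributes `-(x,y)` and the off-diagonal pairs
antisymmetrize, leaving the bivector part. -/
lemma sum_bivector (x y : RVec m) :
    ∑ j : Fin m, ∑ k ∈ Finset.Ioi j, ((y j : ℂ) * x k - (y k : ℂ) * x j) • (e j * e k : CCl m) =
      vec y * vec x + (inner ℝ x y : ℂ) • (1 : CCl m) := by
  rw [vec_eq_sum x, vec_eq_sum y, Finset.sum_mul_sum, sum_Ioi_symm]
  have h1 : ∑ j, (y j : ℂ) • e j * (x j : ℂ) • (e j : CCl m) =
      -((inner ℝ x y : ℂ) • (1 : CCl m)) := by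
    simp only [smul_mul_smul_comm, e_mul_self, ← Finset.sum_smul, smul_neg, Finset.sum_neg_distrib]
    congr 2
    simp [PiLp.inner_apply]
  rw [h1, neg_add_eq_sub, sub_add_cancel]
  refine Finset.sum_congr rfl fun j _ => Finset.sum_congr rfl fun k hk => ?_
  rw [smul_mul_smul_comm, smul_mul_smul_comm, e_mul_e_swap (Finset.mem_Ioi.mp hk).ne, sub_smul,
    smul_neg, sub_eq_add_neg]

/-- Here `e_j e_k e_k = -e_j` and `e_j e_k e_j = e_k`, and each index lies in `m - 1` pairs. In
other words, `Γ_y y = (m - 1) y`. -/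
lemma sum_e_mul_e_mul (y : RVec m) :
    ∑ j : Fin m, ∑ k ∈ Finset.Ioi j, (e j * e k * ((y j : ℂ) • e k - (y k : ℂ) • e j) : CCl m) =
      -((m - 1 : ℂ) • vec y) := by
  have h : ∀ j : Fin m, ∀ k ∈ Finset.Ioi j,
      (e j * e k * ((y j : ℂ) • e k - (y k : ℂ) • e j) : CCl m) =
        -((y j : ℂ) • e j) + -((y k : ℂ) • e k) := by
    intro j k hk
    have h1 : (e j * e k * e k : CCl m) = - e j := by rw [mul_assoc, e_mul_self, mul_neg_one]
    have h2 : (e j * e k * e j : CCl m) = e k := by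
      rw [mul_assoc, e_mul_e_swap (Finset.mem_Ioi.mp hk).ne, mul_neg, ← mul_assoc, e_mul_self,
        neg_one_mul, neg_neg]
    rw [mul_sub, mul_smul_comm, mul_smul_comm, h1, h2, smul_neg, sub_eq_add_neg]
  have h3 := sum_Ioi_symm (fun j k : Fin m => -((y j : ℂ) • (e j : CCl m)))
  rw [Finset.sum_congr rfl fun j _ => Finset.sum_congr rfl (h j), ← sub_eq_iff_eq_add'.mpr h3,
    vec_eq_sum]
  simp only [Finset.sum_neg_distrib, Finset.sum_const, Finset.card_univ, Fintype.card_fin,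
    ← Finset.smul_sum, sub_smul, one_smul]
  rw [Nat.cast_smul_eq_nsmul]
  abel

lemma vec_mul_vec_sq (x y : RVec m) : (vec y * vec x) * (vec y * vec x) =
    -((2 * (inner ℝ x y : ℂ)) • (vec y * vec x)) -
      ((‖x‖ ^ 2 * ‖y‖ ^ 2 : ℝ) : ℂ) • (1 : CCl m) := by
  have h := eq_sub_of_add_eq (vec_mul_vec_add_swap x y)
  rw [show (vec y * vec x) * (vec y * vec x) = vec y * (vec x * vec y) * vec x by noncomm_ring, h,
    mul_sub, sub_mul, mul_smul_comm, mul_one, smul_mul_assoc, ← mul_assoc, vec_mul_self,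
    mul_assoc, vec_mul_self, smul_mul_smul_comm, real_inner_self_eq_norm_sq,
    real_inner_self_eq_norm_sq]
  push_cast
  rw [one_mul, neg_mul, neg_smul]
  congr 2; ring

/-- The map `a ↦ y a x` sends `1` to `yx` and `yx` to `q`, which is how it acts on the entries of
`C_m` in the final formula. -/
lemma vec_mul_conj (x y : RVec m) : vec y * (vec y * vec x) * vec x =
    ((‖x‖ ^ 2 * ‖y‖ ^ 2 : ℝ) : ℂ) • (1 : CCl m) := by
  rw [← mul_assoc, mul_assoc, vec_mul_self, vec_mul_self, smul_mul_smul_comm,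
    real_inner_self_eq_norm_sq, real_inner_self_eq_norm_sq]
  push_cast
  rw [one_mul]
  congr 1; ring

/-! ### Axial functions and eigenfunctions of the angular Dirac operator. -/

/-- A function of the form `u + v y x` with real scalar `u`, `v`. -/
noncomputable def axial (x : RVec m) (u v : RVec m → ℝ) : RVec m → CCl m := fun y =>
  (u y : ℂ) • (1 : CCl m) + (v y : ℂ) • (vec y * vec x)

lemma hasFDerivAt_axial (x : RVec m) {u v : RVec m → ℝ} {u' v' : RVec m →L[ℝ] ℝ} {y : RVec m}
    (hu : HasFDerivAt u u' y) (hv : HasFDerivAt v v' y) :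
    HasFDerivAt (axial x u v) (u'.smulRight (1 : CCl m) +
      (v y • vecMulRight (vec x) + v'.smulRight (vec y * vec x))) y :=
  (hu.smul_const (1 : CCl m)).add (hv.smul (vecMulRight (vec x)).hasFDerivAt)

/-- The gradient components `a'`, `b'` along `y` drop out because `y_j y_k - y_k y_j = 0`. What
remains is the bivector sum times `a + b yx`, together with the action on the vector factor `y`. -/
lemma angularDirac_axial (x : RVec m) {u v : RVec m → ℝ} {a a' b b' : ℝ} {y : RVec m}
    (hu : HasFDerivAt u (a • innerSL ℝ x + a' • innerSL ℝ y) y)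
    (hv : HasFDerivAt v (b • innerSL ℝ x + b' • innerSL ℝ y) y) :
    angularDirac (axial x u v) y =
      ((-(inner ℝ x y) * a + ‖x‖ ^ 2 * ‖y‖ ^ 2 * b : ℝ) : ℂ) • (1 : CCl m) +
        ((-a + inner ℝ x y * b + (m - 1) * v y : ℝ) : ℂ) • (vec y * vec x) := by
  have hp : ∀ j, partialD j (axial x u v) y =
      ((a * x j + a' * y j : ℝ) : ℂ) • (1 : CCl m) + (v y : ℂ) • (e j * vec x) +
        ((b * x j + b' * y j : ℝ) : ℂ) • (vec y * vec x) := by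
    intro j
    rw [partialD, (hasFDerivAt_axial x hu hv).fderiv]
    simp only [add_apply, ContinuousLinearMap.smulRight_apply,
      smul_apply, innerSL_apply_apply, EuclideanSpace.inner_single_right,
      vecMulRight_apply, smul_eq_mul, one_mul]
    rw [add_assoc]
    rfl
  have hs : ∀ j, ∀ k ∈ Finset.Ioi j, e j * e k * ((y j : ℂ) • partialD k (axial x u v) y -
      (y k : ℂ) • partialD j (axial x u v) y) =
      ((y j : ℂ) * x k - (y k : ℂ) * x j) • (e j * e k : CCl m) *
        ((a : ℂ) • (1 : CCl m) + (b : ℂ) • (vec y * vec x)) +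
      (e j * e k * ((y j : ℂ) • e k - (y k : ℂ) • e j) : CCl m) * ((v y : ℂ) • vec x) := by
    intro j k _
    rw [hp, hp]
    push_cast
    simp only [mul_add, mul_sub, sub_mul, smul_add, smul_sub, add_smul, sub_smul,
      mul_smul_comm, smul_mul_assoc, mul_one, smul_smul, mul_assoc]
    module
  simp only [angularDirac]
  rw [Finset.sum_congr rfl fun j _ => Finset.sum_congr rfl (hs j)]
  simp only [Finset.sum_add_distrib, ← Finset.sum_mul]
  rw [sum_bivector, sum_e_mul_e_mul]
  simp only [mul_add, add_mul, mul_smul_comm, smul_mul_assoc, mul_one, one_mul, vec_mul_vec_sq,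
    neg_mul]
  push_cast
  module

variable {m : ℕ}

/-- The gradient of `u` at `y` is `a x + a' y` for some `a'`. -/
def HasAxialGradAt (x : RVec m) (u : RVec m → ℝ) (a : ℝ) (y : RVec m) : Prop :=
  ∃ a' : ℝ, HasFDerivAt u (a • innerSL ℝ x + a' • innerSL ℝ y) y

namespace HasAxialGradAt

variable {x y : RVec m} {u v : RVec m → ℝ} {a b : ℝ}

lemma const (r : ℝ) : HasAxialGradAt x (fun _ => r) 0 y :=
  ⟨0, by simpa using hasFDerivAt_const r y⟩

lemma inner_left : HasAxialGradAt x (fun y => inner ℝ x y) 1 y :=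
  ⟨0, by simpa using (innerSL ℝ x).hasFDerivAt⟩

lemma norm_sq_mul_norm_sq : HasAxialGradAt x (fun y => ‖x‖ ^ 2 * ‖y‖ ^ 2) 0 y := by
  refine ⟨‖x‖ ^ 2 * 2, ?_⟩
  convert! (hasStrictFDerivAt_norm_sq y).hasFDerivAt.const_mul (‖x‖ ^ 2) using 1
  ext z; simp; ring

lemma mul (hu : HasAxialGradAt x u a y) (hv : HasAxialGradAt x v b y) :
    HasAxialGradAt x (fun y => u y * v y) (a * v y + u y * b) y := by
  obtain ⟨a', ha⟩ := hu
  obtain ⟨b', hb⟩ := hv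
  refine ⟨a' * v y + u y * b', ?_⟩
  convert! ha.mul hb using 1
  ext z; simp; ring

lemma sub (hu : HasAxialGradAt x u a y) (hv : HasAxialGradAt x v b y) :
    HasAxialGradAt x (fun y => u y - v y) (a - b) y := by
  obtain ⟨a', ha⟩ := hu
  obtain ⟨b', hb⟩ := hv
  refine ⟨a' - b', ?_⟩
  convert! ha.sub hb using 1
  ext z; simp; ring

lemma gegen (μ : ℝ) (k : ℕ) :
    HasAxialGradAt x (fun y => gegen μ (inner ℝ x y) (‖x‖ ^ 2 * ‖y‖ ^ 2) k)
      (gegenD μ (inner ℝ x y) (‖x‖ ^ 2 * ‖y‖ ^ 2) k) y := by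
  induction k using Nat.twoStepInduction with
  | zero => simpa [gegenD] using const 0
  | one => simpa [gegenD] using const 1
  | more k ih0 ih1 =>
    have h := ((const ((k + 1 : ℝ)⁻¹ * (2 * (k + μ)))).mul (inner_left.mul ih1)).sub
      ((const ((k + 1 : ℝ)⁻¹ * (k + 2 * μ - 1))).mul (norm_sq_mul_norm_sq.mul ih0))
    convert! h using 1
    · ext z; rw [CliffordFourier.gegen]; ring
    · rw [gegenD]; ring

lemma norm_pow (j : ℕ) : HasAxialGradAt x (fun y => (‖x‖ ^ 2 * ‖y‖ ^ 2) ^ j) 0 y := by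
  induction j with
  | zero => simpa using const 1
  | succ j ih => simpa [pow_succ] using ih.mul norm_sq_mul_norm_sq

end HasAxialGradAt

/-- `F` is an eigenfunction of `Γ` for the eigenvalue `l`. -/
def IsEigen (F : RVec m → CCl m) (l : ℤ) : Prop :=
  Differentiable ℝ F ∧ angularDirac F = fun y => (l : ℂ) • F y

lemma isEigen_axial {x : RVec m} {u v : RVec m → ℝ} (u' v' : RVec m → ℝ) {l : ℤ}
    (hu : ∀ y, HasAxialGradAt x u (u' y) y) (hv : ∀ y, HasAxialGradAt x v (v' y) y)
    (h1 : ∀ y, -(inner ℝ x y) * u' y + ‖x‖ ^ 2 * ‖y‖ ^ 2 * v' y = l * u y)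
    (h2 : ∀ y, -u' y + inner ℝ x y * v' y + (m - 1) * v y = l * v y) :
    IsEigen (axial x u v) l := by
  refine ⟨fun y => ?_, funext fun y => ?_⟩
  · obtain ⟨a, ha⟩ := hu y
    obtain ⟨b, hb⟩ := hv y
    exact (hasFDerivAt_axial x ha hb).differentiableAt
  · obtain ⟨a, ha⟩ := hu y
    obtain ⟨b, hb⟩ := hv y
    rw [angularDirac_axial x ha hb, h1, h2, axial, smul_add, smul_smul, smul_smul]
    push_cast
    rfl

/-- `|y|^{2j}` times the zonal monogenic `C_k + C_{k-1} y x`. -/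
noncomputable def zonalMonogenic (x : RVec m) (k j : ℕ) : RVec m → CCl m :=
  axial x
    (fun y => (‖x‖ ^ 2 * ‖y‖ ^ 2) ^ j * gegen (m / 2) (inner ℝ x y) (‖x‖ ^ 2 * ‖y‖ ^ 2) (k + 1))
    (fun y => (‖x‖ ^ 2 * ‖y‖ ^ 2) ^ j * gegen (m / 2) (inner ℝ x y) (‖x‖ ^ 2 * ‖y‖ ^ 2) k)

/-- `|y|^{2j}` times `y (C_{k-1} + C_{k-2} y x) x`. -/
noncomputable def zonalMonogenicConj (x : RVec m) (k j : ℕ) : RVec m → CCl m :=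
  axial x
    (fun y => (‖x‖ ^ 2 * ‖y‖ ^ 2) ^ j * ((‖x‖ ^ 2 * ‖y‖ ^ 2) *
      gegen (m / 2) (inner ℝ x y) (‖x‖ ^ 2 * ‖y‖ ^ 2) (k - 1)))
    (fun y => (‖x‖ ^ 2 * ‖y‖ ^ 2) ^ j * gegen (m / 2) (inner ℝ x y) (‖x‖ ^ 2 * ‖y‖ ^ 2) k)

/-- The coefficients of `1` and of `yx` give the second and the first relation of
`gegenD_identities`. -/
lemma isEigen_zonalMonogenic (x : RVec m) (k j : ℕ) :
    IsEigen (zonalMonogenic x k j) (-(k : ℤ)) := by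
  refine isEigen_axial _ _ (fun y => (HasAxialGradAt.norm_pow j).mul (HasAxialGradAt.gegen _ _))
    (fun y => (HasAxialGradAt.norm_pow j).mul (HasAxialGradAt.gegen _ _)) ?_ ?_
  · intro y
    obtain ⟨-, h2⟩ := gegenD_identities (m / 2) (inner ℝ x y) (‖x‖ ^ 2 * ‖y‖ ^ 2) k
    push_cast
    linear_combination (-(‖x‖ ^ 2 * ‖y‖ ^ 2) ^ j) * h2
  · intro y
    obtain ⟨h1, -⟩ := gegenD_identities (m / 2) (inner ℝ x y) (‖x‖ ^ 2 * ‖y‖ ^ 2) k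
    push_cast
    linear_combination (-(‖x‖ ^ 2 * ‖y‖ ^ 2) ^ j) * h1

/-- The same two relations with their roles exchanged and the index lowered by one. For `k = 0` the
function is zero, so its nominal eigenvalue is harmless. -/
lemma isEigen_zonalMonogenicConj (x : RVec m) (k j : ℕ) :
    IsEigen (zonalMonogenicConj x k j) (k + m - 2) := by
  refine isEigen_axial _ _ (fun y => (HasAxialGradAt.norm_pow j).mul
      (HasAxialGradAt.norm_sq_mul_norm_sq.mul (HasAxialGradAt.gegen _ _)))
    (fun y => (HasAxialGradAt.norm_pow j).mul (HasAxialGradAt.gegen _ _)) ?_ ?_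
  · intro y
    cases k with
    | zero => simp [gegenD]
    | succ k =>
      obtain ⟨h1, -⟩ := gegenD_identities (m / 2) (inner ℝ x y) (‖x‖ ^ 2 * ‖y‖ ^ 2) k
      push_cast
      linear_combination (‖x‖ ^ 2 * ‖y‖ ^ 2) ^ j * (‖x‖ ^ 2 * ‖y‖ ^ 2) * h1
  · intro y
    cases k with
    | zero => simp [gegenD]
    | succ k =>
      obtain ⟨-, h2⟩ := gegenD_identities (m / 2) (inner ℝ x y) (‖x‖ ^ 2 * ‖y‖ ^ 2) k
      push_cast
      linear_combination (‖x‖ ^ 2 * ‖y‖ ^ 2) ^ j * h2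

/-! ### The operator exponential on sums of eigenfunctions. -/

section exponential

variable {ι : Type*} {s : Finset ι} {F : ι → RVec m → CCl m} {l : ι → ℤ}

lemma angularDirac_sum (hF : ∀ i, IsEigen (F i) (l i)) (c : ι → ℂ) :
    angularDirac (fun y => ∑ i ∈ s, c i • F i y) = fun y => ∑ i ∈ s, (c i * l i) • F i y := by
  funext y
  have hp : ∀ j, partialD j (fun y => ∑ i ∈ s, c i • F i y) y =
      ∑ i ∈ s, c i • partialD j (F i) y := by
    intro j
    simp only [partialD]
    rw [fderiv_fun_sum (A := fun i y => c i • F i y) fun i _ => ((hF i).1 y).const_smul (c i)]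
    simp only [sum_apply]
    refine Finset.sum_congr rfl fun i _ => ?_
    rw [fderiv_fun_const_smul ((hF i).1 y)]
    rfl
  have h2 : ∀ i ∈ s, (c i * l i) • F i y = c i • angularDirac (F i) y := by
    intro i _
    rw [(hF i).2, smul_smul]
  rw [Finset.sum_congr rfl h2]
  simp only [angularDirac, hp, smul_neg, Finset.sum_neg_distrib, Finset.smul_sum]
  rw [Finset.sum_comm]
  congr 1
  refine Finset.sum_congr rfl fun j _ => ?_
  rw [Finset.sum_comm]
  refine Finset.sum_congr rfl fun k _ => ?_
  rw [← Finset.sum_sub_distrib, Finset.mul_sum]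
  refine Finset.sum_congr rfl fun i _ => ?_
  rw [smul_comm (y j : ℂ), smul_comm (y k : ℂ), ← smul_sub, mul_smul_comm]

lemma angularDirac_iterate_sum (hF : ∀ i, IsEigen (F i) (l i)) (c : ι → ℂ) (n : ℕ) :
    angularDirac^[n] (fun y => ∑ i ∈ s, c i • F i y) =
      fun y => ∑ i ∈ s, (c i * l i ^ n) • F i y := by
  induction n with
  | zero => simp
  | succ n ih =>
    rw [Function.iterate_succ_apply', ih, angularDirac_sum hF]
    simp only [pow_succ, mul_assoc]

lemma polyAngularDirac_sum (hF : ∀ i, IsEigen (F i) (l i)) (G : Polynomial ℤ) (c : ι → ℂ) :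
    polyAngularDirac G (fun y => ∑ i ∈ s, c i • F i y) =
      fun y => ∑ i ∈ s, (c i * (G.eval (l i) : ℤ)) • F i y := by
  funext y
  simp only [polyAngularDirac, angularDirac_iterate_sum hF, Polynomial.sum, Finset.sum_apply,
    Pi.smul_apply, Finset.smul_sum, smul_smul]
  rw [Finset.sum_comm]
  refine Finset.sum_congr rfl fun i _ => ?_
  rw [← Finset.sum_smul, Polynomial.eval_eq_sum, Polynomial.sum]
  push_cast
  rw [Finset.mul_sum]
  congr 1
  exact Finset.sum_congr rfl fun n _ => by ring

lemma polyAngularDirac_iterate_sum (hF : ∀ i, IsEigen (F i) (l i)) (G : Polynomial ℤ) (c : ι → ℂ)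
    (n : ℕ) : (polyAngularDirac G)^[n] (fun y => ∑ i ∈ s, c i • F i y) =
      fun y => ∑ i ∈ s, (c i * ((G.eval (l i) : ℤ) : ℂ) ^ n) • F i y := by
  induction n with
  | zero => simp
  | succ n ih =>
    rw [Function.iterate_succ_apply', ih, polyAngularDirac_sum hF]
    simp only [pow_succ, mul_assoc]

/-- On an eigenfunction the operator series is the scalar series of `e^{iπN/2} = i^N` with `N =
G(l)`. -/
lemma hasSum_expTerm_sum (hF : ∀ i, IsEigen (F i) (l i)) (G : Polynomial ℤ) (c : ι → ℂ)
    (y : RVec m) : HasSum (fun n => expTerm G n (fun y => ∑ i ∈ s, c i • F i y) y)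
      (∑ i ∈ s, (Complex.I ^ G.eval (l i) * c i) • F i y) := by
  have h : ∀ N : ℤ, HasSum (fun n : ℕ => (Complex.I * (Real.pi : ℂ) / 2) ^ n / (n ! : ℂ) *
      (N : ℂ) ^ n) (Complex.I ^ N) := by
    intro N
    have h := NormedSpace.expSeries_div_hasSum_exp ((N : ℂ) * (Real.pi / 2 * Complex.I))
    rw [← Complex.exp_eq_exp_ℂ, Complex.exp_int_mul, Complex.exp_pi_div_two_mul_I] at h
    convert! h using 2 with n
    rw [div_mul_eq_mul_div, ← mul_pow]
    congr 2; ring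
  simp only [expTerm, polyAngularDirac_iterate_sum hF, Finset.smul_sum, smul_smul]
  refine hasSum_sum fun i _ => ?_
  convert! ((h (G.eval (l i))).mul_right (c i)).smul_const (F i y) using 2 with n
  ring_nf

end exponential

/-! ### Taylor components of the plane wave. -/

lemma homPart_planeWave (t : ℝ) (x : RVec m) (n : ℕ) : homPart n (planeWave t x) =
    fun y => ((-Complex.I * t * (inner ℝ x y : ℝ)) ^ n / (n ! : ℂ)) • (1 : CCl m) := by
  funext y
  set c : ℂ := -Complex.I * t * (inner ℝ x y : ℝ) with hc
  have h0 : (fun r : ℝ => planeWave t x (r • y)) =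
      fun r : ℝ => Complex.exp (c * r) • (1 : CCl m) := by
    funext r
    rw [planeWave, inner_smul_right]
    push_cast
    congr 2
    rw [hc]; ring
  have h1 : iteratedDeriv n (fun r : ℝ => Complex.exp (c * r) • (1 : CCl m)) =
      fun r : ℝ => (c ^ n * Complex.exp (c * r)) • (1 : CCl m) := by
    induction n with
    | zero => simp
    | succ n ih =>
      rw [iteratedDeriv_succ, ih]
      funext r
      have h : HasDerivAt (fun r : ℝ => c ^ n * Complex.exp (c * r))
          (c ^ n * (Complex.exp (c * r) * c)) r := by
        have := ((hasDerivAt_id r).ofReal_comp.const_mul c).cexp.const_mul (c ^ n)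
        simpa using this
      rw [(h.smul_const (1 : CCl m)).deriv]
      congr 1; ring
  rw [homPart, h0, h1, smul_smul]
  simp only [Complex.ofReal_zero, mul_zero, Complex.exp_zero, mul_one]
  congr 1; ring

/-- The expansion of the homogeneous components of the plane wave in eigenfunctions of `Γ`. -/
lemma homPart_planeWave_eq_sum (hm : 1 ≤ m) (t : ℝ) (x : RVec m) (n : ℕ) :
    homPart n (planeWave t x) = fun y => ∑ i ∈ weightPairs n ×ˢ (Finset.univ : Finset Bool),
      (Real.Gamma (m / 2) * (-Complex.I * t / 2) ^ n / (i.1.2 ! * Real.Gamma (i.1.1 + i.1.2 + m / 2))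
        * (if i.2 then 1 else -1) : ℂ) •
      (if i.2 then zonalMonogenic x i.1.1 i.1.2 y else zonalMonogenicConj x i.1.1 i.1.2 y) := by
  have hμ : (0 : ℝ) < m / 2 := by positivity
  rw [homPart_planeWave]
  funext y
  have h := pow_eq_sum_gegen_sub hμ (inner ℝ x y) (‖x‖ ^ 2 * ‖y‖ ^ 2) n
  have h' := congrArg (fun r : ℝ => (r : ℂ)) h
  push_cast at h'
  have e1 : (-Complex.I * t * (inner ℝ x y : ℝ)) ^ n / (n ! : ℂ) =
      (-Complex.I * t / 2) ^ n * ((2 * (inner ℝ x y : ℝ)) ^ n / (n ! : ℂ)) := by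
    rw [← mul_div_assoc, ← mul_pow]; congr 2; ring
  rw [e1, h', Finset.sum_product, Finset.mul_sum, Finset.mul_sum, Finset.sum_smul]
  refine Finset.sum_congr rfl fun p _ => ?_
  -- The `yx` parts of the two families cancel, leaving `C_k - q C_{k-2}`.
  simp only [Fintype.univ_bool, Finset.mem_singleton, Bool.true_eq_false, not_false_eq_true,
    Finset.sum_insert, if_true, Finset.sum_singleton, Bool.false_eq_true, if_false, zonalMonogenic,
    zonalMonogenicConj, axial, besselCoeff]
  push_cast
  module

/-! ### Growth of Bessel functions, uniformly in the order. -/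

open MeasureTheory

lemma Gamma_mul_factorial_le {μ M : ℝ} (hμ : 0 < μ) (hM : 1 ≤ M) (hμM : 1 ≤ μ * M) (n : ℕ) :
    Real.Gamma μ * n ! ≤ Real.Gamma (n + μ) * M ^ n := by
  induction n with
  | zero => simp
  | succ n ih =>
    have h : Real.Gamma ((n + 1 : ℕ) + μ) = (n + μ) * Real.Gamma (n + μ) := by
      rw [← Real.Gamma_add_one (by positivity)]; push_cast; ring_nf
    rw [h, Nat.factorial_succ, pow_succ]
    have h1 : (n + 1 : ℝ) ≤ (n + μ) * M := by nlinarith [(Nat.cast_nonneg n : (0 : ℝ) ≤ n)]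
    have h2 : 0 < Real.Gamma (n + μ) := Real.Gamma_pos_of_pos (by positivity)
    have h3 : 0 < Real.Gamma μ := Real.Gamma_pos_of_pos hμ
    push_cast
    calc Real.Gamma μ * ((n + 1) * n !) = (n + 1) * (Real.Gamma μ * n !) := by ring
      _ ≤ ((n + μ) * M) * (Real.Gamma (n + μ) * M ^ n) := by gcongr
      _ = _ := by ring

lemma exists_inv_Gamma_le {μ : ℝ} (hμ : 0 < μ) :
    ∃ M : ℝ, 1 ≤ M ∧ ∀ n : ℕ, (Real.Gamma (n + μ))⁻¹ ≤ (Real.Gamma μ)⁻¹ * (M ^ n / n !) := by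
  refine ⟨max 1 μ⁻¹, le_max_left _ _, fun n => ?_⟩
  have h := Gamma_mul_factorial_le hμ (le_max_left 1 μ⁻¹)
    (by rw [← mul_inv_cancel₀ hμ.ne']; gcongr; exact le_max_right _ _) n
  have h2 : 0 < Real.Gamma (n + μ) := Real.Gamma_pos_of_pos (by positivity)
  have h3 : 0 < Real.Gamma μ := Real.Gamma_pos_of_pos hμ
  rw [inv_mul_eq_div, div_div, inv_eq_one_div, div_le_div_iff₀ h2 (by positivity)]
  linarith

/-- The regularized hypergeometric function `₀F₁(; ν; z) / Γ(ν)`. -/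
noncomputable def regF (ν z : ℝ) : ℝ := ∑' j : ℕ, z ^ j / (j ! * Real.Gamma (j + ν))

lemma summable_regF {ν : ℝ} (hν : 0 < ν) (z : ℝ) :
    Summable fun j : ℕ => z ^ j / (j ! * Real.Gamma (j + ν)) := by
  obtain ⟨M, hM, h⟩ := exists_inv_Gamma_le hν
  refine .of_norm_bounded ((Real.summable_pow_div_factorial (|z| * M)).mul_left
    (Real.Gamma ν)⁻¹) fun j => ?_
  have h2 : 0 < Real.Gamma (j + ν) := Real.Gamma_pos_of_pos (by positivity)
  have h3 : 0 < Real.Gamma ν := Real.Gamma_pos_of_pos hν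
  rw [norm_div, norm_pow, Real.norm_eq_abs, Real.norm_eq_abs,
    abs_of_pos (mul_pos (by positivity : (0 : ℝ) < j !) h2)]
  have h1 : (1 : ℝ) ≤ j ! := by exact_mod_cast Nat.factorial_pos j
  calc |z| ^ j / (j ! * Real.Gamma (j + ν)) = |z| ^ j / j ! * (Real.Gamma (j + ν))⁻¹ := by
        field_simp
    _ ≤ |z| ^ j / j ! * ((Real.Gamma ν)⁻¹ * (M ^ j / j !)) := by gcongr; exact h j
    _ ≤ |z| ^ j / j ! * ((Real.Gamma ν)⁻¹ * (M ^ j / 1)) := by gcongr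
    _ = _ := by ring

/-- Coefficientwise this is `Γ(j+ν+1) = (ν + j) Γ(j+ν)`, with the factor `j` shifting the summation
index. -/
lemma regF_rec {ν : ℝ} (hν : 0 < ν) (z : ℝ) :
    regF ν z = ν * regF (ν + 1) z + z * regF (ν + 2) z := by
  have h1 := summable_regF (show 0 < ν + 1 by positivity) z
  have h2 := summable_regF (show 0 < ν + 2 by positivity) z
  have h3 : HasSum (fun j : ℕ => j * (z ^ j / (j ! * Real.Gamma (j + (ν + 1)))))
      (z * regF (ν + 2) z) := by
    rw [← hasSum_nat_add_iff' 1]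
    simp only [Finset.range_one, Finset.sum_singleton, Nat.cast_zero, zero_mul, sub_zero]
    convert! h2.hasSum.mul_left z using 2 with j
    rw [Nat.factorial_succ, show ((j + 1 : ℕ) : ℝ) + (ν + 1) = j + (ν + 2) by push_cast; ring]
    have : Real.Gamma (j + (ν + 2)) ≠ 0 := (Real.Gamma_pos_of_pos (by positivity)).ne'
    push_cast
    field_simp
    ring
  have h4 := (h1.hasSum.mul_left ν).add h3
  refine HasSum.unique (summable_regF hν z).hasSum ?_
  convert! h4 using 2 with j
  have h5 : Real.Gamma (j + (ν + 1)) = (j + ν) * Real.Gamma (j + ν) := by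
    rw [← Real.Gamma_add_one (by positivity)]; ring_nf
  have : Real.Gamma (j + ν) ≠ 0 := (Real.Gamma_pos_of_pos (by positivity)).ne'
  rw [h5]
  field_simp
  ring

lemma hasDerivAt_regF {ν : ℝ} (hν : 0 < ν) (z : ℝ) : HasDerivAt (regF ν) (regF (ν + 1) z) z := by
  have hshift : ∀ (r : ℝ) (j : ℕ), ((j + 1 : ℕ) * r ^ (j + 1 - 1)) /
      ((j + 1)! * Real.Gamma ((j + 1 : ℕ) + ν)) = r ^ j / (j ! * Real.Gamma (j + (ν + 1))) := by
    intro r j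
    rw [Nat.factorial_succ, show ((j + 1 : ℕ) : ℝ) + ν = j + (ν + 1) by push_cast; ring]
    have : Real.Gamma (j + (ν + 1)) ≠ 0 := (Real.Gamma_pos_of_pos (by positivity)).ne'
    push_cast
    field_simp
  have hs : ∀ r : ℝ, HasSum (fun j : ℕ => (j * r ^ (j - 1)) / (j ! * Real.Gamma (j + ν)))
      (regF (ν + 1) r) := by
    intro r
    rw [← hasSum_nat_add_iff' 1]
    simp only [Finset.range_one, Finset.sum_singleton, Nat.cast_zero, zero_mul, zero_div, sub_zero,
      hshift]
    exact (summable_regF (by positivity) r).hasSum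
  rw [← (hs z).tsum_eq]
  refine hasDerivAt_tsum_of_isPreconnected
    (g := fun j (z : ℝ) => z ^ j / (j ! * Real.Gamma (j + ν)))
    (g' := fun j (z : ℝ) => (j * z ^ (j - 1)) / (j ! * Real.Gamma (j + ν)))
    (t := Metric.ball 0 (|z| + 1)) (y₀ := 0)
    (hs (|z| + 1)).summable Metric.isOpen_ball (convex_ball _ _).isPreconnected
    (fun j w _ => (hasDerivAt_pow j w).div_const _) (fun j w hw => ?_)
    (Metric.mem_ball_self (by positivity)) (summable_regF hν 0) (by simp)
  have h2 : 0 < Real.Gamma (j + ν) := Real.Gamma_pos_of_pos (by positivity)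
  rw [norm_div, norm_mul, norm_pow, Real.norm_eq_abs, Real.norm_eq_abs, Real.norm_eq_abs,
    abs_of_pos (by positivity : 0 < j ! * Real.Gamma (j + ν)), Nat.abs_cast]
  have : |w| ≤ |z| + 1 := by simpa using (Metric.mem_ball.mp hw).le
  gcongr

lemma continuous_regF {ν : ℝ} (hν : 0 < ν) : Continuous (regF ν) :=
  continuous_iff_continuousAt.mpr fun z => (hasDerivAt_regF hν z).continuousAt

lemma integral_exp_int_mul_I (n : ℤ) :
    ∫ p in Set.Ioc (0 : ℝ) (2 * Real.pi), Complex.exp (n * Complex.I * p) =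
      if n = 0 then 2 * Real.pi else 0 := by
  rw [← intervalIntegral.integral_of_le (by positivity)]
  split_ifs with h
  · simp [h]
  · rw [integral_exp_mul_complex (by simp [h])]
    have : Complex.exp (n * Complex.I * (2 * Real.pi : ℝ)) = 1 := by
      rw [← Complex.exp_int_mul_two_pi_mul_I n]; congr 1; push_cast; ring
    rw [this]; simp

/-- The quantity is the `k`-th Fourier coefficient of `exp(A e^{ir} + B e^{-ir})`, whose modulus is
`e^{(A+B) cos r}`. The point is the exponent `|A + B|`: for `A`, `B` of opposite sign it can be much
smaller than `|A| + |B|`. -/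
lemma regF_nat_bound (A B : ℝ) (k : ℕ) : |A ^ k * regF (k + 1) (A * B)| ≤ Real.exp |A + B| := by
  set F : ℕ × ℕ → ℝ → ℂ := fun p r =>
    ((A : ℂ) ^ p.1 / p.1 ! * ((B : ℂ) ^ p.2 / p.2 !)) *
      Complex.exp (((p.1 - p.2 - k : ℤ) : ℂ) * Complex.I * r) with hF
  have hexp : ∀ x : ℂ, HasSum (fun n : ℕ => x ^ n / n !) (Complex.exp x) := fun x => by
    rw [Complex.exp_eq_exp_ℂ]; exact NormedSpace.expSeries_div_hasSum_exp x
  have hFsum : ∀ r : ℝ, HasSum (fun p => F p r)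
      (Complex.exp (A * Complex.exp (Complex.I * r)) *
        Complex.exp (B * Complex.exp (-(Complex.I * r))) * Complex.exp (-(k * Complex.I * r))) := by
    intro r
    have ha := hexp (A * Complex.exp (Complex.I * r))
    have hb := hexp (B * Complex.exp (-(Complex.I * r)))
    have hab := summable_mul_of_summable_norm ha.summable.norm hb.summable.norm
    have h := (ha.mul hb hab).mul_right (Complex.exp (-(k * Complex.I * r)))
    refine (congrArg (HasSum · _) (funext fun p => ?_)).mpr h
    have e1 : Complex.exp (((p.1 - p.2 - k : ℤ) : ℂ) * Complex.I * r) =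
        Complex.exp (Complex.I * r) ^ p.1 * Complex.exp (-(Complex.I * r)) ^ p.2 *
          Complex.exp (-(k * Complex.I * r)) := by
      rw [← Complex.exp_nat_mul, ← Complex.exp_nat_mul, ← Complex.exp_add, ← Complex.exp_add]
      congr 1; push_cast; ring
    simp only [hF]
    rw [e1]; ring
  have hnorm : ∀ p r, ‖F p r‖ = |A| ^ p.1 / p.1 ! * (|B| ^ p.2 / p.2 !) := by
    intro p r
    have : ‖Complex.exp (((p.1 - p.2 - k : ℤ) : ℂ) * Complex.I * r)‖ = 1 := by
      rw [show ((p.1 - p.2 - k : ℤ) : ℂ) * Complex.I * r =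
        (((p.1 - p.2 - k : ℤ) * r : ℝ) : ℂ) * Complex.I by push_cast; ring]
      exact Complex.norm_exp_ofReal_mul_I _
    simp only [hF]
    rw [norm_mul, this]; simp
  have hint : ∀ p, Integrable (F p) (volume.restrict (Set.Ioc 0 (2 * Real.pi))) := by
    intro p
    have : Continuous (F p) := by simp only [hF]; fun_prop
    exact (this.integrableOn_Icc (a := 0) (b := 2 * Real.pi)).mono_set Set.Ioc_subset_Icc_self
  have hs : Summable fun p => ∫ r in Set.Ioc 0 (2 * Real.pi), ‖F p r‖ := by
    simp only [hnorm, integral_const, smul_eq_mul]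
    exact ((Real.summable_pow_div_factorial |A|).mul_of_nonneg
      (Real.summable_pow_div_factorial |B|) (fun _ => by positivity)
      (fun _ => by positivity)).mul_left _
  have h := hasSum_integral_of_summable_integral_norm hint hs
  have hFint : ∀ p, ∫ r in Set.Ioc 0 (2 * Real.pi), F p r =
      (A : ℂ) ^ p.1 / p.1 ! * ((B : ℂ) ^ p.2 / p.2 !) *
        if (p.1 - p.2 - k : ℤ) = 0 then 2 * Real.pi else 0 := by
    intro p
    simp only [hF]
    rw [integral_const_mul, integral_exp_int_mul_I]
  -- Orthogonality leaves only the pairs `(k + j, j)`.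
  have hinj : Function.Injective (fun j : ℕ => (k + j, j)) := fun a b hab => (Prod.mk.inj hab).2
  rw [← hinj.hasSum_iff] at h
  · have hreg := (summable_regF (show (0 : ℝ) < k + 1 by positivity) (A * B)).hasSum.mul_left
      (2 * Real.pi * A ^ k)
    have hreg' := (Complex.hasSum_ofReal.mpr hreg)
    have heq := h.unique (a₂ := ((2 * Real.pi * A ^ k * regF (k + 1) (A * B) : ℝ) : ℂ)) (by
      convert! hreg' using 2 with j
      simp only [Function.comp_apply, hFint]
      have e1 : (((k + j : ℕ) : ℤ) - j - k = 0) := by push_cast; ring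
      have e2 : Real.Gamma (j + (k + 1)) = (k + j)! := by
        rw [← Real.Gamma_nat_eq_factorial]; push_cast; ring_nf
      rw [if_pos e1, e2]
      push_cast
      field_simp
      ring)
    have hbound : ‖∫ r in Set.Ioc 0 (2 * Real.pi), ∑' p, F p r‖ ≤
        Real.exp |A + B| * volume.real (Set.Ioc 0 (2 * Real.pi)) := by
      refine norm_setIntegral_le_of_norm_le_const measure_Ioc_lt_top fun r _ => ?_
      rw [(hFsum r).tsum_eq, ← Complex.exp_add, ← Complex.exp_add, Complex.norm_exp,
        Real.exp_le_exp]
      have e1 : Complex.exp (Complex.I * r) = Real.cos r + Real.sin r * Complex.I := by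
        rw [mul_comm, Complex.exp_mul_I]; push_cast; rfl
      have e2 : Complex.exp (-(Complex.I * r)) = Real.cos r - Real.sin r * Complex.I := by
        rw [show -(Complex.I * r) = (-r : ℂ) * Complex.I by ring, Complex.exp_mul_I,
          Complex.cos_neg, Complex.sin_neg]; push_cast; ring
      rw [e1, e2]
      simp
      rw [← add_mul]
      calc (A + B) * Real.cos r ≤ |(A + B) * Real.cos r| := le_abs_self _
        _ = |A + B| * |Real.cos r| := abs_mul _ _
        _ ≤ |A + B| * 1 := by gcongr; exact Real.abs_cos_le_one r
        _ = _ := mul_one _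
    rw [heq, Complex.norm_real, Real.norm_eq_abs, mul_assoc, abs_mul,
      abs_of_pos (by positivity : 0 < 2 * Real.pi), Real.volume_real_Ioc_of_le (by positivity),
      sub_zero, mul_comm (Real.exp _)] at hbound
    exact le_of_mul_le_mul_left hbound (by positivity)
  · rintro ⟨a, b⟩ hab
    rw [hFint, if_neg, Complex.ofReal_zero, mul_zero]
    intro h0
    apply hab
    refine ⟨b, ?_⟩
    simp only [Prod.mk.injEq, and_true]
    dsimp only at h0
    omega

lemma integral_pow_mul_one_sub_rpow {ν : ℝ} (hν : 0 < ν) (n : ℕ) :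
    IntegrableOn (fun v : ℝ => v ^ n * (1 - v) ^ (ν - 1)) (Set.Ioc 0 1) ∧
    ∫ v in Set.Ioc (0 : ℝ) 1, v ^ n * (1 - v) ^ (ν - 1) =
      n ! * Real.Gamma ν / Real.Gamma (n + (1 + ν)) := by
  have hn : (0 : ℝ) < ((n + 1 : ℂ)).re := by simp; positivity
  have hν' : 0 < (ν : ℂ).re := by simpa
  have heq : ∀ v ∈ Set.Ioc (0 : ℝ) 1, (v : ℂ) ^ ((n + 1 : ℂ) - 1) * (1 - v : ℂ) ^ ((ν : ℂ) - 1) =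
      ((v ^ n * (1 - v) ^ (ν - 1) : ℝ) : ℂ) := by
    intro v hv
    rw [add_sub_cancel_right, Complex.cpow_natCast]
    push_cast
    rw [Complex.ofReal_cpow (by linarith [hv.2])]
    push_cast; rfl
  have hconv := Complex.betaIntegral_convergent hn hν'
  rw [intervalIntegrable_iff_integrableOn_Ioc_of_le zero_le_one] at hconv
  have hconv' := hconv.congr_fun heq measurableSet_Ioc
  have hre := hconv'.re
  simp only [RCLike.re_eq_complex_re, Complex.ofReal_re] at hre
  refine ⟨hre, ?_⟩
  have hG := Complex.Gamma_mul_Gamma_eq_betaIntegral hn hν'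
  rw [Complex.betaIntegral, intervalIntegral.integral_of_le zero_le_one,
    setIntegral_congr_fun measurableSet_Ioc heq, integral_complex_ofReal,
    Complex.Gamma_nat_eq_factorial, Complex.Gamma_ofReal,
    show ((n : ℂ) + 1 + ν) = ((n + (1 + ν) : ℝ) : ℂ) by push_cast; ring, Complex.Gamma_ofReal] at hG
  have : Real.Gamma (n + (1 + ν)) ≠ 0 := (Real.Gamma_pos_of_pos (by positivity)).ne'
  rw [eq_div_iff this, mul_comm]
  exact_mod_cast hG.symm

/-- A Beta integral against `(1 - v)^{ν-1}` raises the integer order `k + 1` to `k + 1 + ν`, so the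
bound for integer order passes to real order. -/
lemma regF_bound {ν : ℝ} (hν : 0 < ν) (A B : ℝ) (k : ℕ) :
    |A ^ k * regF (k + 1 + ν) (A * B)| ≤ Real.exp |A + B| / (Real.Gamma ν * ν) := by
  have hΓ : 0 < Real.Gamma ν := Real.Gamma_pos_of_pos hν
  set F : ℕ → ℝ → ℝ := fun j v => (A * B) ^ j / (j ! * (k + j)!) * (v ^ (k + j) * (1 - v) ^ (ν - 1))
    with hF
  have hint : ∀ j, Integrable (F j) (volume.restrict (Set.Ioc 0 1)) := fun j =>
    (integral_pow_mul_one_sub_rpow hν (k + j)).1.const_mul _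
  have hcalc : ∀ (z : ℝ) (j : ℕ), z ^ j / (j ! * (k + j)!) *
      ((k + j)! * Real.Gamma ν / Real.Gamma ((k + j : ℕ) + (1 + ν))) =
      Real.Gamma ν * (z ^ j / (j ! * Real.Gamma (j + (k + 1 + ν)))) := by
    intro z j
    have : Real.Gamma (j + (k + 1 + ν)) ≠ 0 := (Real.Gamma_pos_of_pos (by positivity)).ne'
    rw [show ((k + j : ℕ) : ℝ) + (1 + ν) = j + (k + 1 + ν) by push_cast; ring]
    field_simp
  have hFint : ∀ j, ∫ v in Set.Ioc 0 1, F j v =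
      Real.Gamma ν * ((A * B) ^ j / (j ! * Real.Gamma (j + (k + 1 + ν)))) := by
    intro j
    simp only [hF]
    rw [integral_const_mul, (integral_pow_mul_one_sub_rpow hν (k + j)).2, hcalc]
  have hnorm : ∀ j, ∫ v in Set.Ioc 0 1, ‖F j v‖ =
      Real.Gamma ν * (|A * B| ^ j / (j ! * Real.Gamma (j + (k + 1 + ν)))) := by
    intro j
    rw [← hcalc, ← (integral_pow_mul_one_sub_rpow hν (k + j)).2, ← integral_const_mul]
    refine setIntegral_congr_fun measurableSet_Ioc fun v hv => ?_
    have h1 : 0 ≤ 1 - v := by linarith [hv.2]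
    have h2 : 0 ≤ v := hv.1.le
    simp only [hF]
    rw [norm_mul, Real.norm_eq_abs, Real.norm_eq_abs,
      abs_of_nonneg (by positivity : 0 ≤ v ^ (k + j) * (1 - v) ^ (ν - 1)), abs_div, abs_pow,
      abs_of_pos (by positivity : (0 : ℝ) < j ! * (k + j)!)]
  have h := hasSum_integral_of_summable_integral_norm hint (by
    simp only [hnorm]; exact (summable_regF (by positivity) _).mul_left _)
  simp only [hFint] at h
  have heq := h.unique ((summable_regF (show 0 < k + 1 + ν by positivity) (A * B)).hasSum.mul_left
    (Real.Gamma ν))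
  have hpt : ∀ v ∈ Set.Ioc (0 : ℝ) 1, |A ^ k * ∑' j, F j v| ≤
      Real.exp |A + B| * (v ^ 0 * (1 - v) ^ (ν - 1)) := by
    intro v hv
    have h1 : 0 ≤ 1 - v := by linarith [hv.2]
    have h2 : 0 ≤ v := hv.1.le
    have hs : ∑' j, F j v = v ^ k * regF (k + 1) (v * (A * B)) * (1 - v) ^ (ν - 1) := by
      rw [regF, ← tsum_mul_left, ← tsum_mul_right]
      refine tsum_congr fun j => ?_
      have e2 : Real.Gamma (j + (k + 1)) = (k + j)! := by
        rw [← Real.Gamma_nat_eq_factorial]; push_cast; ring_nf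
      rw [e2]
      simp only [hF]
      ring
    -- Giving `√v` to each of `A` and `B` scales the product by `v` and the exponent `|A + B|` only
    -- by `√v ≤ 1`.
    have hb := regF_nat_bound (√v * A) (√v * B) k
    rw [show √v * A * (√v * B) = (√v * √v) * (A * B) by ring, Real.mul_self_sqrt h2] at hb
    have hsq1 : √v ≤ 1 := Real.sqrt_le_one.mpr hv.2
    have e3 : A ^ k * (v ^ k * regF (k + 1) (v * (A * B)) * (1 - v) ^ (ν - 1)) =
        √v ^ k * ((√v * A) ^ k * regF (k + 1) (v * (A * B))) * (1 - v) ^ (ν - 1) := by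
      nth_rewrite 1 [← Real.mul_self_sqrt h2]; ring
    rw [hs, e3, abs_mul, abs_mul, abs_of_nonneg (by positivity : 0 ≤ √v ^ k),
      abs_of_nonneg (by positivity : 0 ≤ (1 - v) ^ (ν - 1)), pow_zero, one_mul]
    gcongr
    calc √v ^ k * |(√v * A) ^ k * regF (k + 1) (v * (A * B))| ≤
        1 * Real.exp |√v * A + √v * B| := by
          gcongr
          exact pow_le_one₀ (Real.sqrt_nonneg v) hsq1
      _ ≤ Real.exp |A + B| := by
          rw [one_mul, ← mul_add, abs_mul, abs_of_nonneg (Real.sqrt_nonneg v)]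
          gcongr
          exact mul_le_of_le_one_left (abs_nonneg _) hsq1
  have hbase := integral_pow_mul_one_sub_rpow hν 0
  have hI : |∫ v in Set.Ioc 0 1, A ^ k * ∑' j, F j v| ≤
      ∫ v in Set.Ioc (0 : ℝ) 1, Real.exp |A + B| * (v ^ 0 * (1 - v) ^ (ν - 1)) := by
    rw [← Real.norm_eq_abs]
    exact norm_integral_le_of_norm_le (hbase.1.const_mul _)
      ((ae_restrict_iff' measurableSet_Ioc).mpr (Filter.Eventually.of_forall hpt))
  rw [integral_const_mul, integral_const_mul, hbase.2, heq] at hI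
  have e4 : Real.Gamma ((0 : ℕ) + (1 + ν)) = ν * Real.Gamma ν := by
    rw [← Real.Gamma_add_one hν.ne']; congr 1; push_cast; ring
  rw [e4] at hI
  rw [le_div_iff₀ (by positivity)]
  have e5 : |A ^ k * (Real.Gamma ν * ∑' j : ℕ, (A * B) ^ j / (j ! * Real.Gamma (j + (k + 1 + ν))))|
      = Real.Gamma ν * |A ^ k * regF (k + 1 + ν) (A * B)| := by
    rw [mul_left_comm, abs_mul, abs_of_pos hΓ]; rfl
  rw [e5, Nat.factorial_zero, Nat.cast_one, one_mul] at hI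
  have e6 : Real.exp |A + B| * (Real.Gamma ν / (ν * Real.Gamma ν)) = Real.exp |A + B| / ν := by
    field_simp
  rw [e6, le_div_iff₀ hν] at hI
  linarith

/-- `t^{1-μ}` times the Bessel function of order `k + μ - 1`, up to normalization. -/
noncomputable def bes (μ q : ℝ) (k : ℕ) (t : ℝ) : ℝ := t ^ k * regF (k + μ) (-q * t ^ 2 / 4)

/-- Apply `regF_bound` with `A = ta`, `B = -qt/(4a)` and `a` slightly above `√q/2`, where `A + B`
nearly cancels. That bound needs order above `k + 1`, while `μ` may be `1/2`, so `regF_rec` first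
raises the order. Its factor `k + μ` is absorbed by passing from `a` to `ϱ < a`, and its factor `t²`
by half of the exponential. -/
lemma exists_bes_bound {μ q : ℝ} (hμ : 0 < μ) (hq : 0 ≤ q) {ε : ℝ} (hε : 0 < ε) :
    ∃ ϱ C : ℝ, √q / 2 < ϱ ∧ ∀ k : ℕ, ∀ t : ℝ, 0 ≤ t →
      |bes μ q k t| * ϱ ^ k ≤ C * Real.exp (ε * t) := by
  set a := √q / 2 + ε / 4 with ha
  set ϱ := √q / 2 + ε / 8 with hϱ
  have hsq : 0 ≤ √q := Real.sqrt_nonneg q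
  have hsq2 : √q ^ 2 = q := Real.sq_sqrt hq
  have ha0 : 0 < a := by positivity
  have hϱ0 : 0 < ϱ := by positivity
  have hϱa : ϱ < a := by simp only [ha, hϱ]; linarith
  have hr1 : ϱ / a < 1 := (div_lt_one ha0).mpr hϱa
  obtain ⟨C₁, hC₁⟩ : ∃ C₁, ∀ k : ℕ, (k + μ) * (ϱ / a) ^ k ≤ C₁ := by
    have h1 := tendsto_self_mul_const_pow_of_abs_lt_one
      (show |ϱ / a| < 1 by rwa [abs_of_pos (by positivity)])
    have h2 := tendsto_pow_atTop_nhds_zero_of_lt_one (by positivity : 0 ≤ ϱ / a) hr1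
    obtain ⟨C₁, hC₁⟩ := (h1.add (h2.const_mul μ)).bddAbove_range
    refine ⟨C₁, fun k => ?_⟩
    have := hC₁ (Set.mem_range_self k)
    simpa [add_mul] using this
  set D₁ := (Real.Gamma μ * μ)⁻¹ with hD₁
  set D₂ := (Real.Gamma (μ + 1) * (μ + 1))⁻¹ with hD₂
  have hΓ1 : 0 < Real.Gamma μ := Real.Gamma_pos_of_pos hμ
  have hΓ2 : 0 < Real.Gamma (μ + 1) := Real.Gamma_pos_of_pos (by positivity)
  have hD1 : 0 < D₁ := by positivity
  have hD2 : 0 < D₂ := by positivity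
  refine ⟨ϱ, C₁ * D₁ + q / 4 * (2 / (ε / 2) ^ 2) * D₂, by simp only [hϱ]; linarith,
    fun k t ht => ?_⟩
  have hAB : (t * a) * (-q * t / (4 * a)) = -q * t ^ 2 / 4 := by field_simp
  have hsum : |t * a + -q * t / (4 * a)| ≤ ε / 2 * t := by
    have e1 : t * a + -q * t / (4 * a) = t * ((4 * a ^ 2 - q) / (4 * a)) := by field_simp; ring
    have e2 : 4 * a ^ 2 - q = (2 * a - √q) * (2 * a + √q) := by nlinarith
    have e3 : 2 * a - √q = ε / 2 := by simp only [ha]; ring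
    rw [e1, abs_mul, abs_of_nonneg ht, mul_comm t, e2, e3]
    gcongr
    rw [abs_of_nonneg (by positivity), div_le_iff₀ (by positivity)]
    have : 2 * a + √q ≤ 4 * a := by linarith
    nlinarith
  have hexp : Real.exp |t * a + -q * t / (4 * a)| ≤ Real.exp (ε / 2 * t) := Real.exp_le_exp.mpr hsum
  have b1 := regF_bound hμ (t * a) (-q * t / (4 * a)) k
  have b2 := regF_bound (show 0 < μ + 1 by positivity) (t * a) (-q * t / (4 * a)) k
  rw [hAB, show (k : ℝ) + 1 + μ = k + μ + 1 by ring] at b1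
  rw [hAB, show (k : ℝ) + 1 + (μ + 1) = k + μ + 2 by ring] at b2
  have b1' : |(t * a) ^ k * regF (k + μ + 1) (-q * t ^ 2 / 4)| ≤ Real.exp (ε / 2 * t) * D₁ := by
    rw [hD₁, ← div_eq_mul_inv]
    exact b1.trans (by gcongr)
  have b2' : |(t * a) ^ k * regF (k + μ + 2) (-q * t ^ 2 / 4)| ≤ Real.exp (ε / 2 * t) * D₂ := by
    rw [hD₂, ← div_eq_mul_inv]
    exact b2.trans (by gcongr)
  have ht2 : t ^ 2 ≤ 2 / (ε / 2) ^ 2 * Real.exp (ε / 2 * t) := by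
    have := Real.quadratic_le_exp_of_nonneg (x := ε / 2 * t) (by positivity)
    rw [div_mul_eq_mul_div, le_div_iff₀ (by positivity)]
    nlinarith [show 0 ≤ ε / 2 * t by positivity]
  have hE1 : Real.exp (ε / 2 * t) ≤ Real.exp (ε * t) := by
    apply Real.exp_le_exp.mpr; nlinarith
  have hE2 : Real.exp (ε / 2 * t) * Real.exp (ε / 2 * t) = Real.exp (ε * t) := by
    rw [← Real.exp_add]; ring_nf
  have hexpand : bes μ q k t * ϱ ^ k = (ϱ / a) ^ k * ((k + μ) * ((t * a) ^ k *
      regF (k + μ + 1) (-q * t ^ 2 / 4)) + (-q * t ^ 2 / 4) * ((t * a) ^ k *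
      regF (k + μ + 2) (-q * t ^ 2 / 4))) := by
    rw [bes, regF_rec (by positivity), div_pow, mul_pow]
    field_simp
  have hr0 : 0 ≤ (ϱ / a) ^ k := by positivity
  have hrk : (ϱ / a) ^ k ≤ 1 := pow_le_one₀ (by positivity) hr1.le
  have hϱk : |ϱ ^ k| = ϱ ^ k := abs_of_pos (by positivity)
  rw [← hϱk, ← abs_mul, hexpand, abs_mul, abs_of_nonneg hr0]
  calc (ϱ / a) ^ k * |(k + μ) * ((t * a) ^ k * regF (k + μ + 1) (-q * t ^ 2 / 4)) +
        (-q * t ^ 2 / 4) * ((t * a) ^ k * regF (k + μ + 2) (-q * t ^ 2 / 4))|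
      ≤ (ϱ / a) ^ k * ((k + μ) * (Real.exp (ε / 2 * t) * D₁) +
        (q / 4 * t ^ 2) * (Real.exp (ε / 2 * t) * D₂)) := by
        gcongr
        refine (abs_add_le _ _).trans ?_
        rw [abs_mul, abs_mul (-q * t ^ 2 / 4), abs_of_pos (by positivity : 0 < (k : ℝ) + μ),
          show |-q * t ^ 2 / 4| = q / 4 * t ^ 2 by
            rw [show -q * t ^ 2 / 4 = -(q / 4 * t ^ 2) by ring, abs_neg,
              abs_of_nonneg (by positivity)]]
        gcongr
    _ = ((k + μ) * (ϱ / a) ^ k) * (Real.exp (ε / 2 * t) * D₁) + (ϱ / a) ^ k *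
        ((q / 4 * t ^ 2) * (Real.exp (ε / 2 * t) * D₂)) := by ring
    _ ≤ C₁ * (Real.exp (ε * t) * D₁) + 1 * ((q / 4 *
        (2 / (ε / 2) ^ 2 * Real.exp (ε / 2 * t))) * (Real.exp (ε / 2 * t) * D₂)) := by
        have hC1 : 0 ≤ C₁ := le_trans (by positivity) (hC₁ 0)
        gcongr
        exact hC₁ k
    _ = C₁ * (Real.exp (ε * t) * D₁) + q / 4 * (2 / (ε / 2) ^ 2) * D₂ *
        (Real.exp (ε / 2 * t) * Real.exp (ε / 2 * t)) := by ring
    _ = _ := by rw [hE2]; ring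

/-! ### The Laplace kernel and domination by it. -/

/-- The kernel `e^{-st} t^{μ-1}`. -/
noncomputable def lapKer (μ : ℝ) (s : ℂ) (t : ℝ) : ℂ :=
  Complex.exp (-s * (t : ℂ)) * ((t ^ (μ - 1) : ℝ) : ℂ)

lemma norm_lapKer (μ : ℝ) (s : ℂ) {t : ℝ} (ht : 0 < t) :
    ‖lapKer μ s t‖ = t ^ (μ - 1) * Real.exp (-s.re * t) := by
  rw [lapKer, norm_mul, Complex.norm_exp, Complex.norm_real, Real.norm_eq_abs,
    abs_of_nonneg (by positivity), mul_comm]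
  simp

lemma measurable_lapKer (μ : ℝ) (s : ℂ) : Measurable (lapKer μ s) := by
  unfold lapKer; fun_prop

lemma integrableOn_rpow_mul_exp {μ : ℝ} (hμ : 0 < μ) {b : ℝ} (hb : 0 < b) :
    IntegrableOn (fun t : ℝ => t ^ (μ - 1) * Real.exp (-b * t)) (Set.Ioi 0) := by
  simpa using integrableOn_rpow_mul_exp_neg_mul_rpow (show -1 < μ - 1 by linarith) one_pos hb

lemma norm_lapKer_mul_le {μ : ℝ} {s : ℂ} {h : ℝ → ℂ} {C ε : ℝ}
    (hC : ∀ t > 0, ‖h t‖ ≤ C * Real.exp (ε * t)) {t : ℝ} (ht : 0 < t) :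
    ‖lapKer μ s t * h t‖ ≤ C * (t ^ (μ - 1) * Real.exp (-(s.re - ε) * t)) := by
  rw [norm_mul, norm_lapKer μ s ht]
  calc t ^ (μ - 1) * Real.exp (-s.re * t) * ‖h t‖
      ≤ t ^ (μ - 1) * Real.exp (-s.re * t) * (C * Real.exp (ε * t)) := by gcongr; exact hC t ht
    _ = C * (t ^ (μ - 1) * (Real.exp (-s.re * t) * Real.exp (ε * t))) := by ring
    _ = _ := by rw [← Real.exp_add]; ring_nf

lemma integrableOn_lapKer_mul {μ : ℝ} (hμ : 0 < μ) {s : ℂ} {h : ℝ → ℂ} {C ε : ℝ}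
    (hε : ε < s.re) (hm : AEStronglyMeasurable h (volume.restrict (Set.Ioi 0)))
    (hC : ∀ t > 0, ‖h t‖ ≤ C * Real.exp (ε * t)) :
    IntegrableOn (fun t => lapKer μ s t * h t) (Set.Ioi 0) := by
  refine Integrable.mono' ((integrableOn_rpow_mul_exp hμ (sub_pos.mpr hε)).const_mul C)
    ((measurable_lapKer μ s).aestronglyMeasurable.mul hm) ?_
  exact (ae_restrict_iff' measurableSet_Ioi).mpr (.of_forall fun t ht => norm_lapKer_mul_le hC ht)

lemma integral_norm_lapKer_mul_le {μ : ℝ} (hμ : 0 < μ) {s : ℂ} {h : ℝ → ℂ} {C ε : ℝ}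
    (hε : ε < s.re) (hm : AEStronglyMeasurable h (volume.restrict (Set.Ioi 0)))
    (hC : ∀ t > 0, ‖h t‖ ≤ C * Real.exp (ε * t)) :
    ∫ t in Set.Ioi 0, ‖lapKer μ s t * h t‖ ≤
      C * ∫ t in Set.Ioi (0 : ℝ), t ^ (μ - 1) * Real.exp (-(s.re - ε) * t) := by
  rw [← integral_const_mul]
  exact setIntegral_mono_on (integrableOn_lapKer_mul hμ hε hm hC).norm
    ((integrableOn_rpow_mul_exp hμ (sub_pos.mpr hε)).const_mul C) measurableSet_Ioi
    fun t ht => norm_lapKer_mul_le hC ht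

/-! ### Laplace transforms of the Bessel functions. -/

section bes

variable {μ q : ℝ}

lemma continuous_bes (hμ : 0 < μ) (k : ℕ) : Continuous (bes μ q k) := by
  have := continuous_regF (show 0 < k + μ by positivity)
  unfold bes; fun_prop

/-- The Laplace transform of `t^{μ-1} bes μ q k`. -/
noncomputable def lapBes (μ q : ℝ) (s : ℂ) (k : ℕ) : ℂ :=
  ∫ t in Set.Ioi (0 : ℝ), lapKer μ s t * (bes μ q k t : ℂ)

lemma exists_norm_bes_le (hμ : 0 < μ) (hq : 0 ≤ q) {ε : ℝ} (hε : 0 < ε) :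
    ∃ ϱ C : ℝ, √q / 2 < ϱ ∧ ∀ k : ℕ, ∀ t > 0,
      ‖(bes μ q k t : ℂ)‖ ≤ C * (ϱ⁻¹) ^ k * Real.exp (ε * t) := by
  obtain ⟨ϱ, C, hϱ, h⟩ := exists_bes_bound hμ hq hε
  have hϱ0 : 0 < ϱ := lt_of_le_of_lt (by positivity) hϱ
  refine ⟨ϱ, C, hϱ, fun k t ht => ?_⟩
  rw [Complex.norm_real, Real.norm_eq_abs, inv_pow, mul_right_comm, ← div_eq_mul_inv,
    le_div_iff₀ (by positivity)]
  exact h k t ht.le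

lemma aestronglyMeasurable_bes (hμ : 0 < μ) (k : ℕ) (ν : Measure ℝ) :
    AEStronglyMeasurable (fun t => (bes μ q k t : ℂ)) ν :=
  (Complex.continuous_ofReal.comp (continuous_bes hμ k)).aestronglyMeasurable

lemma integrableOn_lapKer_mul_bes (hμ : 0 < μ) (hq : 0 ≤ q) {s : ℂ} (hs : 0 < s.re) (k : ℕ) :
    IntegrableOn (fun t => lapKer μ s t * (bes μ q k t : ℂ)) (Set.Ioi 0) := by
  obtain ⟨ϱ, C, -, h⟩ := exists_norm_bes_le hμ hq (half_pos hs)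
  exact integrableOn_lapKer_mul hμ (by linarith) (aestronglyMeasurable_bes hμ k _) (h k)

/-- This is `2 J_ν' = J_{ν-1} - J_{ν+1}` in the present normalization. -/
lemma hasDerivAt_rpow_mul_bes (hμ : 0 < μ) (k : ℕ) {t : ℝ} (ht : 0 < t) :
    HasDerivAt (fun t => t ^ (μ - 1) * bes μ q (k + 1) t)
      (t ^ (μ - 1) * (bes μ q k t - q / 4 * bes μ q (k + 2) t)) t := by
  have h1 := Real.hasDerivAt_rpow_const (p := μ - 1) (Or.inl ht.ne')
  have hz : HasDerivAt (fun t : ℝ => -q * t ^ 2 / 4) (-q * (2 * t) / 4) t := by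
    simpa using ((hasDerivAt_pow 2 t).const_mul (-q)).div_const 4
  have h2 := ((hasDerivAt_regF (show 0 < (k + 1 : ℕ) + μ by positivity) _).comp t hz)
  have h3 := h1.mul ((hasDerivAt_pow (k + 1) t).mul h2)
  refine h3.congr_deriv ?_
  have e1 : t ^ (μ - 1 - 1) = t ^ (μ - 1) / t := by rw [Real.rpow_sub_one ht.ne']
  simp only [bes, Pi.mul_apply, Function.comp_apply, e1, Nat.add_sub_cancel]
  rw [regF_rec (show 0 < k + μ by positivity)]
  push_cast
  rw [show (k : ℝ) + 1 + μ = k + μ + 1 by ring, show (k : ℝ) + 2 + μ = k + μ + 2 by ring,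
    show (k : ℝ) + μ + 1 + 1 = k + μ + 2 by ring]
  field_simp
  ring

/-- The derivative of `e^{-st} t^{μ-1} bes μ q (k+1) t` integrates to zero over the half-line. -/
lemma lapBes_rec (hμ : 0 < μ) (hq : 0 ≤ q) {s : ℂ} (hs : 0 < s.re) (k : ℕ) :
    s * lapBes μ q s (k + 1) = lapBes μ q s k - q / 4 * lapBes μ q s (k + 2) := by
  have hi := integrableOn_lapKer_mul_bes hμ hq hs
  have hderiv : ∀ t ∈ Set.Ioi (0 : ℝ), HasDerivAt (fun t => lapKer μ s t * (bes μ q (k + 1) t : ℂ))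
      (-s * (lapKer μ s t * (bes μ q (k + 1) t : ℂ)) + (lapKer μ s t * (bes μ q k t : ℂ) -
        q / 4 * (lapKer μ s t * (bes μ q (k + 2) t : ℂ)))) t := by
    intro t ht
    have h1 : HasDerivAt (fun t : ℝ => Complex.exp (-s * t)) (Complex.exp (-s * t) * -s) t := by
      have := ((hasDerivAt_id t).ofReal_comp.const_mul (-s)).cexp
      simpa using this
    have h2 := h1.mul (hasDerivAt_rpow_mul_bes (q := q) hμ k ht).ofReal_comp
    convert! h2 using 1
    · funext t; simp only [lapKer, Pi.mul_apply]; push_cast; ring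
    · simp only [lapKer]; push_cast; ring
  have hint : IntegrableOn (fun t => -s * (lapKer μ s t * (bes μ q (k + 1) t : ℂ)) +
      (lapKer μ s t * (bes μ q k t : ℂ) - q / 4 * (lapKer μ s t * (bes μ q (k + 2) t : ℂ))))
      (Set.Ioi 0) :=
    ((hi (k + 1)).const_mul _).add ((hi k).sub ((hi (k + 2)).const_mul _))
  -- Near `0` the function is of order `t^{μ+k}`. At `0` itself the value of `0^{μ-1}` is irrelevant
  -- because `bes μ q (k+1)` vanishes there.
  have hcont : ContinuousWithinAt (fun t => lapKer μ s t * (bes μ q (k + 1) t : ℂ)) (Set.Ici 0) 0 := by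
    have hc := continuous_regF (show 0 < (k + 1 : ℕ) + μ by positivity)
    have hr : Continuous fun t : ℝ => t ^ μ := Real.continuous_rpow_const hμ.le
    have hg : Continuous fun t : ℝ => Complex.exp (-s * t) * ((t ^ μ : ℝ) : ℂ) *
        ((t ^ k * regF ((k + 1 : ℕ) + μ) (-q * t ^ 2 / 4) : ℝ) : ℂ) := by fun_prop
    refine hg.continuousWithinAt.congr ?_ ?_
    · intro t ht
      rcases (Set.mem_Ici.mp ht).eq_or_lt with rfl | ht
      · simp [bes, Real.zero_rpow hμ.ne']
      · simp only [lapKer, bes]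
        rw [Real.rpow_sub_one ht.ne']
        have : (t : ℂ) ≠ 0 := by exact_mod_cast ht.ne'
        push_cast
        field_simp
        ring
    · simp [bes, Real.zero_rpow hμ.ne']
  have h := integral_Ioi_of_hasDerivAt_of_tendsto hcont hderiv hint
    (tendsto_zero_of_hasDerivAt_of_integrableOn_Ioi hderiv hint (hi (k + 1)))
  have hadd := integral_add (g := fun t => lapKer μ s t * (bes μ q k t : ℂ) -
    q / 4 * (lapKer μ s t * (bes μ q (k + 2) t : ℂ))) ((hi (k + 1)).const_mul (-s))
    ((hi k).sub ((hi (k + 2)).const_mul (q / 4 : ℂ)))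
  rw [hadd, integral_sub (hi k) ((hi (k + 2)).const_mul _), integral_const_mul,
    integral_const_mul] at h
  have h0 : bes μ q (k + 1) 0 = 0 := by simp [bes]
  rw [h0, Complex.ofReal_zero, mul_zero, sub_zero] at h
  simp only [lapBes]
  linear_combination -h

lemma exists_norm_lapBes_le (hμ : 0 < μ) (hq : 0 ≤ q) {s : ℂ} (hs : 0 < s.re) :
    ∃ ϱ C : ℝ, √q / 2 < ϱ ∧ ∀ k : ℕ, ‖lapBes μ q s k‖ ≤ C * (ϱ⁻¹) ^ k := by
  obtain ⟨ϱ, C, hϱ, h⟩ := exists_norm_bes_le hμ hq (half_pos hs)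
  refine ⟨ϱ, C * ∫ t in Set.Ioi (0 : ℝ), t ^ (μ - 1) * Real.exp (-(s.re - s.re / 2) * t), hϱ,
    fun k => (norm_integral_le_integral_norm _).trans ?_⟩
  rw [mul_right_comm]
  exact integral_norm_lapKer_mul_le hμ (by linarith) (aestronglyMeasurable_bes hμ k _) (h k)

/-- For `q > 0` the recurrence has characteristic roots `1/σ` and `-4σ/q`. The defect `E k` sees
only the second, whose modulus is at least `2/√q`, while `E k = O(ϱ^{-k})` with `ϱ > √q/2`. Hence
the defect is zero. -/
lemma lapBes_eq (hμ : 0 < μ) (hq : 0 ≤ q) {s σ : ℂ} (hs : 0 < s.re) (hσ : √q / 2 ≤ ‖σ‖)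
    (hσ0 : σ ≠ 0) (hsσ : s = σ - q / (4 * σ)) (k : ℕ) :
    lapBes μ q s k = lapBes μ q s 0 * (σ⁻¹) ^ k := by
  obtain ⟨ϱ, C, hϱ, hC⟩ := exists_norm_lapBes_le hμ hq hs
  have hϱ0 : 0 < ϱ := lt_of_le_of_lt (by positivity) hϱ
  have hσn : 0 < ‖σ‖ := norm_pos_iff.mpr hσ0
  have hC0 : 0 ≤ C := by simpa using (norm_nonneg _).trans (hC 0)
  set E : ℕ → ℂ := fun k => lapBes μ q s (k + 1) - lapBes μ q s k / σ with hE
  have hEC : ∀ k, ‖E k‖ ≤ (C * ϱ⁻¹ + C / ‖σ‖) * (ϱ⁻¹) ^ k := by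
    intro k
    refine (norm_sub_le _ _).trans ?_
    rw [norm_div]
    calc _ ≤ C * ϱ⁻¹ ^ (k + 1) + C * ϱ⁻¹ ^ k / ‖σ‖ := by gcongr <;> exact hC _
      _ = _ := by ring
  have hErec : ∀ k, E k = -(q / (4 * σ)) * E (k + 1) := by
    intro k
    have h := lapBes_rec hμ hq hs k
    apply mul_left_cancel₀ hσ0
    simp only [hE]
    rw [hsσ] at h ⊢
    field_simp at h ⊢
    linear_combination h
  have hEn : ∀ n k, E k = (-(q / (4 * σ))) ^ n * E (k + n) := by
    intro n
    induction n with
    | zero => simp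
    | succ n ih =>
      intro k
      rw [ih k, hErec (k + n), pow_succ]; ring_nf
  have hlt : q / (4 * ‖σ‖) * ϱ⁻¹ < 1 := by
    rw [← div_eq_mul_inv, div_div, div_lt_one (by positivity)]
    have h1 := Real.sq_sqrt hq
    nlinarith [Real.sqrt_nonneg q, mul_pos hσn (sub_pos.mpr hϱ),
      mul_nonneg (sub_nonneg.mpr hσ) (Real.sqrt_nonneg q)]
  have hE0 : ∀ k, E k = 0 := by
    intro k
    rw [← norm_le_zero_iff]
    have hlim := (tendsto_pow_atTop_nhds_zero_of_lt_one (by positivity) hlt).const_mul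
      ((C * ϱ⁻¹ + C / ‖σ‖) * (ϱ⁻¹) ^ k)
    rw [mul_zero] at hlim
    refine ge_of_tendsto' hlim fun n => ?_
    rw [hEn n k, norm_mul, norm_pow, norm_neg, norm_div, norm_mul, Complex.norm_real,
      Real.norm_eq_abs, abs_of_nonneg hq, Complex.norm_ofNat]
    calc _ ≤ (q / (4 * ‖σ‖)) ^ n * ((C * ϱ⁻¹ + C / ‖σ‖) * (ϱ⁻¹) ^ (k + n)) := by
          gcongr; exact hEC _
      _ = _ := by rw [mul_pow, pow_add]; ring
  induction k with
  | zero => simp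
  | succ k ih =>
    have := sub_eq_zero.mp (hE0 k)
    rw [this, ih, pow_succ]; field_simp

/-- Termwise integration. Summability is assumed for every `ϱ > √q/2` because the `ϱ` of the growth
bound is only known to exist. -/
lemma lapKer_mul_tsum (hμ : 0 < μ) (hq : 0 ≤ q) {s : ℂ} (hs : 0 < s.re) {X : ℕ → ℂ}
    (hX : ∀ ϱ, √q / 2 < ϱ → Summable fun k => ‖X k‖ * (ϱ⁻¹) ^ k) :
    IntegrableOn (fun t => lapKer μ s t * ∑' k, X k * (bes μ q k t : ℂ)) (Set.Ioi 0) ∧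
    ∫ t in Set.Ioi (0 : ℝ), lapKer μ s t * ∑' k, X k * (bes μ q k t : ℂ) =
      ∑' k, X k * lapBes μ q s k := by
  obtain ⟨ϱ, C, hϱ, h⟩ := exists_norm_bes_le hμ hq (half_pos hs)
  have hϱ0 : 0 < ϱ := lt_of_le_of_lt (by positivity) hϱ
  have hXs := hX ϱ hϱ
  have hb : ∀ k, ∀ t > 0, ‖X k * (bes μ q k t : ℂ)‖ ≤
      C * (‖X k‖ * (ϱ⁻¹) ^ k) * Real.exp (s.re / 2 * t) := by
    intro k t ht
    rw [norm_mul]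
    calc _ ≤ ‖X k‖ * (C * (ϱ⁻¹) ^ k * Real.exp (s.re / 2 * t)) := by gcongr; exact h k t ht
      _ = _ := by ring
  have hsum : ∀ t > 0, Summable fun k => X k * (bes μ q k t : ℂ) := fun t ht =>
    .of_norm_bounded ((hXs.mul_left C).mul_right _) fun k => hb k t ht
  have hmeas : ∀ k, AEStronglyMeasurable (fun t => X k * (bes μ q k t : ℂ))
      (volume.restrict (Set.Ioi 0)) := fun k => (aestronglyMeasurable_bes hμ k _).const_mul _
  have hmeasΨ : AEStronglyMeasurable (fun t => ∑' k, X k * (bes μ q k t : ℂ))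
      (volume.restrict (Set.Ioi 0)) := by
    refine aestronglyMeasurable_of_tendsto_ae Filter.atTop
      (f := fun n t => ∑ k ∈ Finset.range n, X k * (bes μ q k t : ℂ))
      (fun n => Finset.aestronglyMeasurable_fun_sum _ fun k _ => hmeas k) ?_
    exact (ae_restrict_iff' measurableSet_Ioi).mpr
      (.of_forall fun t ht => (hsum t ht).hasSum.tendsto_sum_nat)
  have hint : ∀ k, IntegrableOn (fun t => lapKer μ s t * (X k * (bes μ q k t : ℂ))) (Set.Ioi 0) :=
    fun k => integrableOn_lapKer_mul hμ (by linarith) (hmeas k) (hb k)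
  refine ⟨integrableOn_lapKer_mul (C := ∑' k, C * (‖X k‖ * (ϱ⁻¹) ^ k)) hμ
    (show s.re / 2 < s.re by linarith) hmeasΨ ?_, ?_⟩
  · intro t ht
    rw [← tsum_mul_right]
    exact tsum_of_norm_bounded ((hXs.mul_left C).mul_right _).hasSum fun k => hb k t ht
  · have hsn : Summable fun k => ∫ t in Set.Ioi (0 : ℝ),
        ‖lapKer μ s t * (X k * (bes μ q k t : ℂ))‖ := by
      refine .of_nonneg_of_le (fun k => by positivity) (fun k =>
        integral_norm_lapKer_mul_le hμ (show s.re / 2 < s.re by linarith) (hmeas k) (hb k))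
        ((hXs.mul_left C).mul_right _)
    have hs' := hasSum_integral_of_summable_integral_norm hint hsn
    simp only [tsum_mul_left] at hs'
    rw [← hs'.tsum_eq]
    refine tsum_congr fun k => ?_
    rw [lapBes, ← integral_const_mul]
    congr 1; funext t; ring

end bes

/-! ### The Laplace transform of a power, for complex `s`. -/

lemma lapKer_mul_self (μ : ℝ) (s : ℂ) {t : ℝ} (ht : 0 < t) :
    lapKer μ s t * t = lapKer (μ + 1) s t := by
  rw [lapKer, lapKer, show μ + 1 - 1 = μ - 1 + 1 by ring, Real.rpow_add_one ht.ne']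
  push_cast; ring

lemma integrableOn_lapKer {μ : ℝ} (hμ : 0 < μ) {s : ℂ} (hs : 0 < s.re) :
    IntegrableOn (lapKer μ s) (Set.Ioi 0) := by
  simpa using integrableOn_lapKer_mul (h := fun _ => 1) (C := 1) (ε := 0) hμ hs
    aestronglyMeasurable_const (by simp)

/-- The case `q = 0` of `lapBes_rec`, where the Bessel functions are monomials. -/
lemma mul_integral_lapKer_add_one {μ : ℝ} (hμ : 0 < μ) {s : ℂ} (hs : 0 < s.re) :
    s * ∫ t in Set.Ioi 0, lapKer (μ + 1) s t = μ * ∫ t in Set.Ioi 0, lapKer μ s t := by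
  have h := lapBes_rec hμ le_rfl hs 0
  have hreg : ∀ ν : ℝ, regF ν 0 = (Real.Gamma ν)⁻¹ := by
    intro ν
    rw [regF, tsum_eq_single 0 (by intro j hj; simp [hj])]
    simp
  have hΓ : Real.Gamma μ ≠ 0 := (Real.Gamma_pos_of_pos hμ).ne'
  have h0 : lapBes μ 0 s 0 = (Real.Gamma μ : ℂ)⁻¹ * ∫ t in Set.Ioi 0, lapKer μ s t := by
    rw [lapBes, ← integral_const_mul]
    congr 1; funext t
    simp [bes, hreg]; ring
  have h1 : lapBes μ 0 s (0 + 1) =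
      (Real.Gamma (μ + 1) : ℂ)⁻¹ * ∫ t in Set.Ioi 0, lapKer (μ + 1) s t := by
    rw [lapBes, ← integral_const_mul]
    refine setIntegral_congr_fun measurableSet_Ioi fun t ht => ?_
    simp only [bes, ← lapKer_mul_self μ s ht]
    simp [hreg, add_comm 1 μ]; ring
  rw [h0, h1, Real.Gamma_add_one hμ.ne'] at h
  have hΓ' : (Real.Gamma μ : ℂ) ≠ 0 := by exact_mod_cast hΓ
  have hμ' : (μ : ℂ) ≠ 0 := by exact_mod_cast hμ.ne'
  push_cast at h
  simp only [zero_div, zero_mul, sub_zero] at h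
  field_simp at h
  simpa using h

lemma hasDerivAt_integral_lapKer {μ : ℝ} (hμ : 0 < μ) {s : ℂ} (hs : 0 < s.re) :
    HasDerivAt (fun s => ∫ t in Set.Ioi 0, lapKer μ s t)
      (-∫ t in Set.Ioi 0, lapKer (μ + 1) s t) s := by
  rw [← integral_neg]
  refine (hasDerivAt_integral_of_dominated_loc_of_deriv_le
    (F := fun s t => lapKer μ s t) (F' := fun s t => -lapKer (μ + 1) s t)
    (bound := fun t => t ^ (μ + 1 - 1) * Real.exp (-(s.re / 2) * t))
    (Metric.ball_mem_nhds s (half_pos hs))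
    (.of_forall fun z => (measurable_lapKer μ z).aestronglyMeasurable)
    (integrableOn_lapKer hμ hs) (measurable_lapKer _ s).neg.aestronglyMeasurable ?_
    (integrableOn_rpow_mul_exp (by positivity) (half_pos hs)) ?_).2
  · refine (ae_restrict_iff' measurableSet_Ioi).mpr (.of_forall fun t ht z hz => ?_)
    have ht : 0 < t := ht
    rw [norm_neg, norm_lapKer _ _ ht]
    gcongr
    have := (Complex.abs_re_le_norm (z - s)).trans_lt (mem_ball_iff_norm.mp hz)
    rw [Complex.sub_re] at this
    linarith [(abs_lt.mp this).1]
  · refine (ae_restrict_iff' measurableSet_Ioi).mpr (.of_forall fun t ht z _ => ?_)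
    have ht : 0 < t := ht
    rw [← lapKer_mul_self μ z ht]
    have h1 : HasDerivAt (fun z : ℂ => Complex.exp (-z * t)) (Complex.exp (-z * t) * (-1 * t)) z :=
      (((hasDerivAt_id z).neg).mul_const (t : ℂ)).cexp
    refine (h1.mul_const _).congr_deriv ?_
    rw [lapKer]; ring

/-- The product of the integral with `s^μ` has zero derivative on the right half-plane, and at `s =
1` it is `Γ(μ)`. -/
lemma integral_lapKer {μ : ℝ} (hμ : 0 < μ) {s : ℂ} (hs : 0 < s.re) :
    ∫ t in Set.Ioi 0, lapKer μ s t = Real.Gamma μ * s ^ (-μ : ℂ) := by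
  have hopen : IsOpen {z : ℂ | 0 < z.re} := isOpen_lt continuous_const Complex.continuous_re
  have hconn : IsPreconnected {z : ℂ | 0 < z.re} := (convex_halfSpace_re_gt 0).isPreconnected
  have hne : ∀ z : ℂ, 0 < z.re → z ≠ 0 := by rintro z hz rfl; simp at hz
  have hd : ∀ z : ℂ, 0 < z.re →
      HasDerivAt (fun z => (∫ t in Set.Ioi 0, lapKer μ z t) * z ^ (μ : ℂ)) 0 z := by
    intro z hz
    have h2 := (hasDerivAt_id z).cpow_const (c := (μ : ℂ)) (Or.inl hz)
    refine ((hasDerivAt_integral_lapKer hμ hz).mul h2).congr_deriv ?_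
    have h3 := mul_integral_lapKer_add_one hμ hz
    have hz0 := hne z hz
    have h4 : z ^ (μ : ℂ) = z ^ ((μ : ℂ) - 1) * z := by
      rw [Complex.cpow_sub _ _ hz0, Complex.cpow_one]; field_simp
    simp only [id, mul_one]
    rw [h4]
    linear_combination (-z ^ ((μ : ℂ) - 1)) * h3
  have hc := hopen.is_const_of_deriv_eq_zero hconn
    (fun z hz => (hd z hz).differentiableAt.differentiableWithinAt) (fun z hz => (hd z hz).deriv)
    (show s ∈ {z : ℂ | 0 < z.re} from hs) (show (1 : ℂ) ∈ {z : ℂ | 0 < z.re} by simp)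
  have h1 : ∫ t in Set.Ioi 0, lapKer μ 1 t = Real.Gamma μ := by
    rw [Real.Gamma_eq_integral hμ, ← integral_complex_ofReal]
    congr 1; funext t
    rw [lapKer]; push_cast; ring_nf
  simp only [h1, Complex.one_cpow, mul_one] at hc
  rw [← hc, Complex.cpow_neg, mul_assoc, mul_inv_cancel₀, mul_one]
  simp [Complex.cpow_eq_zero_iff, hne s hs]

/-! ### The Gegenbauer generating function. -/

section generating

variable {μ w q : ℝ}

lemma mul_mem_slitPlane_of_re_pos {a b : ℂ} (ha : 0 < a.re) (hb : 0 < b.re) :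
    a * b ∈ Complex.slitPlane := by
  rw [Complex.mem_slitPlane_iff]
  by_contra! h
  obtain ⟨h1, h2⟩ := h
  rw [Complex.mul_re] at h1
  rw [Complex.mul_im] at h2
  have h3 : a.re * (b.re ^ 2 + b.im ^ 2) = b.re * (a.re * b.re - a.im * b.im) := by
    linear_combination b.im * h2
  have h4 : 0 < a.re * (b.re ^ 2 + b.im ^ 2) := by positivity
  nlinarith

/-- Factor into `1 - (w ± id)τ` with `|w ± id| = √q`. Both factors have positive real part, so their
product avoids the negative axis. -/
lemma generating_mem_slitPlane (hw : w ^ 2 ≤ q) {τ : ℂ} (hτ : ‖τ‖ * √q < 1) :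
    1 - 2 * w * τ + q * τ ^ 2 ∈ Complex.slitPlane := by
  set d := √(q - w ^ 2) with hd
  have hd2 : d ^ 2 = q - w ^ 2 := Real.sq_sqrt (by linarith)
  have hfac : 1 - 2 * w * τ + q * τ ^ 2 = (1 - (w + d * Complex.I) * τ) *
      (1 - (w - d * Complex.I) * τ) := by
    have : (d : ℂ) ^ 2 = q - w ^ 2 := by exact_mod_cast hd2
    have hI := Complex.I_sq
    linear_combination (-τ ^ 2) * this + d ^ 2 * τ ^ 2 * hI
  have hn : ∀ e : ℝ, e ^ 2 = q - w ^ 2 → 0 < (1 - (w + e * Complex.I) * τ).re := by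
    intro e he
    have h1 : ‖(w + e * Complex.I : ℂ)‖ = √q := by
      rw [Complex.norm_add_mul_I, he]; congr 1; ring
    have h2 := (Complex.re_le_norm ((w + e * Complex.I) * τ))
    rw [norm_mul, h1, mul_comm (√q)] at h2
    rw [Complex.sub_re, Complex.one_re]
    linarith
  rw [hfac]
  refine mul_mem_slitPlane_of_re_pos (hn d hd2) ?_
  have := hn (-d) (by rw [neg_sq, hd2])
  rwa [show (w : ℂ) - d * Complex.I = w + ((-d : ℝ) : ℂ) * Complex.I by push_cast; ring]

/-- The function solves `P f' = 2μ(w - qz) f` with `P` the quadratic. Differentiating repeatedly and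
evaluating at `0` gives the recurrence of `gegen` for the Taylor coefficients. -/
lemma hasSum_gegen (hw : w ^ 2 ≤ q) {τ : ℂ} (hτ : ‖τ‖ * √q < 1) :
    HasSum (fun k => (gegen μ w q (k + 1) : ℂ) * τ ^ k)
      ((1 - 2 * w * τ + q * τ ^ 2) ^ (-μ : ℂ)) := by
  set f : ℂ → ℂ := fun τ => (1 - 2 * w * τ + q * τ ^ 2) ^ (-μ : ℂ) with hf
  set U : Set ℂ := {τ | ‖τ‖ * √q < 1} with hU
  have hUo : IsOpen U := isOpen_lt (by fun_prop) continuous_const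
  have hP : ∀ z : ℂ, HasDerivAt (fun τ : ℂ => 1 - 2 * w * τ + q * τ ^ 2) (-2 * w + 2 * q * z) z := by
    intro z
    have h := (((hasDerivAt_id z).const_mul (2 * w : ℂ)).const_sub 1).add
      ((hasDerivAt_pow 2 z).const_mul (q : ℂ))
    refine h.congr_deriv ?_
    push_cast; ring
  have hfd : ∀ z ∈ U, HasDerivAt f (-μ * (1 - 2 * w * z + q * z ^ 2) ^ (-μ - 1 : ℂ) *
      (-2 * w + 2 * q * z)) z := fun z hz =>
    (hP z).cpow_const (generating_mem_slitPlane hw hz)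
  have hfan : AnalyticOnNhd ℂ f U :=
    DifferentiableOn.analyticOnNhd (fun z hz => (hfd z hz).differentiableAt.differentiableWithinAt)
      hUo
  set D : ℕ → ℂ → ℂ := fun n => iteratedDeriv n f with hD
  have hDd : ∀ n, ∀ z ∈ U, HasDerivAt (D n) (D (n + 1) z) z := by
    intro n z hz
    have h := (hfan.iterated_deriv n z hz).differentiableAt.hasDerivAt
    rw [← iteratedDeriv_eq_iterate, ← iteratedDeriv_succ] at h
    exact h
  have hode : ∀ z ∈ U, (1 - 2 * w * z + q * z ^ 2) * D 1 z = 2 * μ * (w - q * z) * D 0 z := by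
    intro z hz
    have h1 : D 1 z = deriv f z := by simp [hD]
    have hne := Complex.slitPlane_ne_zero (generating_mem_slitPlane hw hz)
    rw [h1, (hfd z hz).deriv, Complex.cpow_sub _ _ hne, Complex.cpow_one]
    simp only [hD, hf, iteratedDeriv_zero]
    generalize 1 - 2 * w * z + q * z ^ 2 = P at hne
    field_simp
    ring
  -- `Q n` is the `(n+1)`-st derivative of the differential equation, by Leibniz' rule.
  set Q : ℕ → ℂ → ℂ := fun n z => (1 - 2 * w * z + q * z ^ 2) * D (n + 2) z +
    (n + 1) * (-2 * w + 2 * q * z) * D (n + 1) z + (n + 1) * n * q * D n z -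
    (2 * μ * (w - q * z) * D (n + 1) z - 2 * μ * q * (n + 1) * D n z) with hQ
  have hlin : ∀ z : ℂ, HasDerivAt (fun z : ℂ => -2 * w + 2 * q * z) (2 * q) z := by
    intro z
    simpa using ((hasDerivAt_id z).const_mul (2 * q : ℂ)).const_add (-2 * w : ℂ)
  have hlin' : ∀ z : ℂ, HasDerivAt (fun z : ℂ => 2 * μ * (w - q * z)) (-2 * μ * q) z := by
    intro z
    refine ((((hasDerivAt_id z).const_mul (q : ℂ)).const_sub (w : ℂ)).const_mul
      (2 * μ : ℂ)).congr_deriv ?_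
    ring
  have hQ0 : ∀ n, ∀ z ∈ U, Q n z = 0 := by
    intro n
    induction n with
    | zero =>
      intro z hz
      have h1 := (((hP z).mul (hDd 1 z hz)).sub ((hlin' z).mul (hDd 0 z hz)))
      have h2 : (fun z => (1 - 2 * w * z + q * z ^ 2) * D 1 z - 2 * μ * (w - q * z) * D 0 z)
          =ᶠ[nhds z] fun _ => 0 := by
        filter_upwards [hUo.mem_nhds hz] with y hy
        rw [hode y hy, sub_self]
      have h3 := h1.unique ((hasDerivAt_const z (0 : ℂ)).congr_of_eventuallyEq h2)
      simp only [hQ]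
      push_cast
      linear_combination h3
    | succ n ih =>
      intro z hz
      have h1 := ((((hP z).mul (hDd (n + 2) z hz)).add
        (((hlin z).const_mul (n + 1 : ℂ)).mul (hDd (n + 1) z hz))).add
        ((hDd n z hz).const_mul ((n + 1) * n * q : ℂ))).sub
        (((hlin' z).mul (hDd (n + 1) z hz)).sub ((hDd n z hz).const_mul (2 * μ * q * (n + 1) : ℂ)))
      have h2 : Q n =ᶠ[nhds z] fun _ => 0 := by
        filter_upwards [hUo.mem_nhds hz] with y hy using ih y hy
      have h3 := h1.unique ((hasDerivAt_const z (0 : ℂ)).congr_of_eventuallyEq h2)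
      simp only [hQ]
      push_cast
      linear_combination h3
  have hU0 : (0 : ℂ) ∈ U := by simp [hU]
  have hD0 : D 0 0 = 1 := by simp [hD, hf]
  have hcoef : ∀ n, D n 0 = n ! * (gegen μ w q (n + 1) : ℂ) := by
    intro n
    induction n using Nat.twoStepInduction with
    | zero => simp [hD0]
    | one =>
      have h := hode 0 hU0
      have hg := gegen_rec μ w q 0
      rw [hD0] at h
      simp at h hg
      rw [h]; simp [hg]
    | more n ih0 ih1 =>
      have h := hQ0 n 0 hU0
      have hg := congrArg (fun r : ℝ => (r : ℂ)) (gegen_rec μ w q (n + 1))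
      simp only [hQ] at h
      rw [ih0, ih1] at h
      push_cast at h hg
      rw [Nat.factorial_succ] at h ⊢
      rw [Nat.factorial_succ]
      push_cast at h ⊢
      linear_combination h - (n + 1) * n ! * hg
  obtain ⟨R, hR1, hR2⟩ : ∃ R : ℝ, ‖τ‖ < R ∧ R * √q < 1 := by
    have h0 := Real.sqrt_nonneg q
    -- The denominator `√q + 1` keeps the radius meaningful when `q = 0`.
    refine ⟨‖τ‖ + (1 - ‖τ‖ * √q) / (√q + 1), ?_, ?_⟩
    · have : 0 < (1 - ‖τ‖ * √q) / (√q + 1) := div_pos (by linarith) (by linarith)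
      linarith
    · have : (1 - ‖τ‖ * √q) / (√q + 1) * √q < 1 - ‖τ‖ * √q := by
        rw [div_mul_eq_mul_div, div_lt_iff₀ (by linarith)]
        nlinarith
      rw [add_mul]; linarith
  have hball : Metric.ball (0 : ℂ) R ⊆ U := by
    intro z hz
    have hz' : ‖z‖ < R := by simpa using hz
    exact lt_of_le_of_lt (mul_le_mul_of_nonneg_right hz'.le (Real.sqrt_nonneg q)) hR2
  have hR0 : 0 ≤ R := (norm_nonneg τ).trans hR1.le
  have ht := Complex.hasSum_taylorSeries_on_ball (c := 0) (r := R) (f := f) (z := τ)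
    (hfan.differentiableOn.mono hball) (by simpa using hR1)
  convert! ht using 2 with n
  change _ = (n ! : ℂ)⁻¹ • (τ - 0) ^ n • D n 0
  rw [hcoef]
  have : (n ! : ℂ) ≠ 0 := by exact_mod_cast n.factorial_ne_zero
  simp only [sub_zero, smul_eq_mul]
  field_simp

end generating

/-! ### Principal branches of the square root and of the powers. -/

section branches

/-- Under either alternative `arg a - arg b` stays in `(-π, π]`, so the logarithm of the quotient is
the difference of the logarithms. -/
lemma div_cpow_of_arg {a b : ℂ} (ha : a ≠ 0) (hb : 0 < b.re)
    (h : 0 < a.re ∨ 0 < a.im * b.im) (c : ℂ) : (a / b) ^ c = a ^ c / b ^ c := by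
  have hb0 : b ≠ 0 := by rintro rfl; simp at hb
  have hπ := Real.pi_pos
  have hbarg := abs_lt.mp (Complex.abs_arg_lt_pi_div_two_iff.mpr (Or.inl hb))
  have hbπ : b.arg ≠ Real.pi := by linarith [hbarg.2]
  have hrange : a.arg - b.arg ∈ Set.Ioc (-Real.pi) Real.pi := by
    rcases h with h | h
    · have haarg := abs_lt.mp (Complex.abs_arg_lt_pi_div_two_iff.mpr (Or.inl h))
      exact ⟨by linarith [haarg.1, hbarg.2], by linarith [haarg.2, hbarg.1]⟩
    · rcases pos_and_pos_or_neg_and_neg_of_mul_pos h with ⟨h1, h2⟩ | ⟨h1, h2⟩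
      · have e1 := Complex.arg_nonneg_iff.mpr h1.le
        have e2 := Complex.arg_nonneg_iff.mpr h2.le
        exact ⟨by linarith [hbarg.2], by linarith [Complex.arg_le_pi a]⟩
      · have e1 := Complex.arg_neg_iff.mpr h1
        have e2 := Complex.arg_neg_iff.mpr h2
        exact ⟨by linarith [Complex.neg_pi_lt_arg a], by linarith [hbarg.1]⟩
  have hlog : Complex.log (a / b) = Complex.log a - Complex.log b := by
    rw [div_eq_mul_inv, (Complex.log_mul_eq_add_log_iff ha (inv_ne_zero hb0)).mpr,
      Complex.log_inv _ hbπ, sub_eq_add_neg]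
    rwa [Complex.arg_inv, if_neg hbπ, ← sub_eq_add_neg]
  rw [Complex.cpow_def_of_ne_zero (div_ne_zero ha hb0), Complex.cpow_def_of_ne_zero ha,
    Complex.cpow_def_of_ne_zero hb0, hlog, sub_mul, Complex.exp_sub]

variable {s S : ℂ} {q w : ℝ}

lemma sq_add_mem_slitPlane (hs : 0 < s.re) (hq : 0 ≤ q) : s ^ 2 + q ∈ Complex.slitPlane := by
  rw [Complex.mem_slitPlane_iff]
  by_contra! h
  obtain ⟨h1, h2⟩ := h
  simp [pow_two] at h1 h2
  have : s.im = 0 := by nlinarith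
  rw [this] at h1
  nlinarith

lemma re_sqrt_pos (hs : 0 < s.re) (hq : 0 ≤ q) : 0 < ((s ^ 2 + q) ^ (1 / 2 : ℂ)).re := by
  have h := sq_add_mem_slitPlane hs hq
  have h0 := Complex.slitPlane_ne_zero h
  rw [Complex.cpow_def_of_ne_zero h0, Complex.exp_re]
  refine mul_pos (Real.exp_pos _) (Real.cos_pos_of_mem_Ioo ?_)
  have him : (Complex.log (s ^ 2 + q) * (1 / 2)).im = (s ^ 2 + q : ℂ).arg / 2 := by
    rw [show (1 / 2 : ℂ) = ((1 / 2 : ℝ) : ℂ) by push_cast; rfl, Complex.im_mul_ofReal,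
      Complex.log_im]; ring
  have h1 := Complex.neg_pi_lt_arg (s ^ 2 + q)
  have h2 : (s ^ 2 + q : ℂ).arg < Real.pi :=
    lt_of_le_of_ne (Complex.arg_le_pi _) (Complex.mem_slitPlane_iff_arg.mp h).1
  rw [him]
  exact ⟨by linarith, by linarith⟩

lemma sqrt_sq (s : ℂ) (q : ℝ) : ((s ^ 2 + q) ^ (1 / 2 : ℂ)) ^ 2 = s ^ 2 + q := by
  rw [show (1 / 2 : ℂ) = ((2 : ℕ) : ℂ)⁻¹ by push_cast; ring]
  exact Complex.cpow_nat_inv_pow _ two_ne_zero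

lemma im_relation (hS : S ^ 2 = s ^ 2 + q) : S.re * S.im = s.re * s.im := by
  have := congrArg Complex.im hS
  simp [pow_two] at this
  linarith

lemma half_add_identities (hs : 0 < s.re) (hSre : 0 < S.re) (hS : S ^ 2 = s ^ 2 + q) :
    (s + S) / 2 ≠ 0 ∧ s = (s + S) / 2 - q / (4 * ((s + S) / 2)) ∧
      S = (s + S) / 2 + q / (4 * ((s + S) / 2)) := by
  have h0 : s + S ≠ 0 := by
    intro h
    have := congrArg Complex.re h
    simp at this; linarith
  refine ⟨div_ne_zero h0 two_ne_zero, ?_, ?_⟩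
  · field_simp; linear_combination (-4) * hS
  · field_simp; linear_combination 4 * hS

/-- Taking real parts in `s = σ - q/(4σ)` gives `Re s = Re σ · (1 - q/(4|σ|²))`, and both real parts
are positive. -/
lemma sqrt_lt_norm_half_add (hs : 0 < s.re) (hSre : 0 < S.re) (hS : S ^ 2 = s ^ 2 + q) :
    √q / 2 < ‖(s + S) / 2‖ := by
  obtain ⟨h0, h1, -⟩ := half_add_identities hs hSre hS
  set σ := (s + S) / 2 with hσ
  have hσre : 0 < σ.re := by simp [hσ]; linarith
  have hn : 0 < ‖σ‖ := norm_pos_iff.mpr h0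
  have h2 : (q / (4 * σ) : ℂ).re = q * σ.re / (4 * ‖σ‖ ^ 2) := by
    rw [show (q / (4 * σ) : ℂ) = ((q / 4 : ℝ) : ℂ) * σ⁻¹ by push_cast; field_simp,
      Complex.re_ofReal_mul, Complex.inv_re, Complex.normSq_eq_norm_sq]
    field_simp
  have h3 := congrArg Complex.re h1
  rw [Complex.sub_re, h2] at h3
  have h4 : q * σ.re / (4 * ‖σ‖ ^ 2) < σ.re := by linarith
  rw [div_lt_iff₀ (by positivity), mul_comm σ.re] at h4
  have h5 : q < (2 * ‖σ‖) ^ 2 := by nlinarith [lt_of_mul_lt_mul_right h4 hσre.le]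
  have h6 := (Real.sqrt_lt' (by positivity)).mpr h5
  linarith

lemma div_half_add_cpow_of_re (hs : 0 < s.re) (hSre : 0 < S.re) {N : ℂ} (hN : 0 < N.re) (c : ℂ) :
    (N / ((s + S) / 2)) ^ c = N ^ c / ((s + S) / 2) ^ c :=
  div_cpow_of_arg (by rintro rfl; simp at hN) (by simp; linarith) (Or.inl hN) c

/-- `S + w` may leave the right half-plane. If `S` is not real, `Re S · Im S = Re s · Im s` shows
that its imaginary part has the sign of `Im s`. If `S` is real, then so is `s`, and `S > |w|`. -/
lemma div_half_add_cpow_of_sqrt (hs : 0 < s.re) (hSre : 0 < S.re) (hS : S ^ 2 = s ^ 2 + q)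
    (hw : w ^ 2 ≤ q) (c : ℂ) :
    ((S + w) / ((s + S) / 2)) ^ c = (S + w) ^ c / ((s + S) / 2) ^ c := by
  have him := im_relation hS
  by_cases h0 : S.im = 0
  · have hs0 : s.im = 0 := by
      rw [h0, mul_zero] at him
      exact (mul_eq_zero.mp him.symm).resolve_left hs.ne'
    have hre := congrArg Complex.re hS
    simp [pow_two, h0, hs0] at hre
    refine div_half_add_cpow_of_re hs hSre ?_ c
    rw [Complex.add_re, Complex.ofReal_re]
    nlinarith [mul_pos hs hs]
  · have hpos : 0 < S.im * s.im := by
      have : 0 < S.im ^ 2 := by positivity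
      have h1 : s.re * (S.im * s.im) = S.re * S.im ^ 2 := by linear_combination (-S.im) * him
      have h2 : 0 < s.re * (S.im * s.im) := by rw [h1]; positivity
      exact (mul_pos_iff_of_pos_left hs).mp h2
    refine div_cpow_of_arg ?_ (by simp; linarith) (Or.inr ?_) c
    · intro h
      have := congrArg Complex.im h
      simp at this
      exact h0 this
    · simp
      nlinarith [sq_nonneg S.im]

end branches

/-! ### Laplace transforms of Bessel series with periodic multipliers. -/

/-- The coefficients of a power series that converges absolutely for `|τ| √q < 1`. -/
def ConvCoeff (q : ℝ) (X : ℕ → ℂ) : Prop :=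
  ∀ r : ℝ, 0 ≤ r → r * √q < 1 → Summable fun k => ‖X k‖ * r ^ k

section series

variable {μ w q : ℝ} {X Y : ℕ → ℂ}

lemma convCoeff_gegen (hw : w ^ 2 ≤ q) : ConvCoeff q fun k => (gegen μ w q (k + 1) : ℂ) := by
  intro r hr hrq
  have h := (hasSum_gegen (μ := μ) hw (τ := (r : ℂ)) (by simpa [abs_of_nonneg hr])).summable.norm
  simpa [abs_of_nonneg hr] using h

lemma ConvCoeff.bounded_mul (hX : ConvCoeff q X) {c : ℕ → ℂ} {M : ℝ} (hc : ∀ k, ‖c k‖ ≤ M) :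
    ConvCoeff q fun k => c k * X k := by
  intro r hr hrq
  refine .of_nonneg_of_le (fun k => by positivity) (fun k => ?_) ((hX r hr hrq).mul_left M)
  rw [norm_mul, mul_assoc]
  gcongr
  exact hc k

lemma ConvCoeff.sub (hX : ConvCoeff q X) (hY : ConvCoeff q Y) :
    ConvCoeff q fun k => X k - Y k := by
  intro r hr hrq
  refine .of_nonneg_of_le (fun k => by positivity) (fun k => ?_) ((hX r hr hrq).add (hY r hr hrq))
  rw [← add_mul]
  gcongr
  exact norm_sub_le _ _

lemma ConvCoeff.of_succ (hX : ConvCoeff q fun k => X (k + 1)) : ConvCoeff q X := by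
  intro r hr hrq
  rw [← summable_nat_add_iff 1]
  convert! (hX r hr hrq).mul_right r using 2 with k
  rw [pow_succ]; ring

lemma ConvCoeff.exists_norm_le (hX : ConvCoeff q X) :
    ∃ M R : ℝ, 0 ≤ R ∧ ∀ k, ‖X k‖ ≤ M * R ^ k := by
  have h0 := Real.sqrt_nonneg q
  have h1 : (√q + 1)⁻¹ * √q < 1 := by
    rw [inv_mul_lt_iff₀ (by linarith)]; linarith
  have hs := hX (√q + 1)⁻¹ (by positivity) h1
  refine ⟨∑' k, ‖X k‖ * (√q + 1)⁻¹ ^ k, √q + 1, by positivity, fun k => ?_⟩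
  have := hs.le_tsum k fun j _ => by positivity
  rwa [inv_pow, ← div_eq_mul_inv, div_le_iff₀ (by positivity)] at this

/-- A double series over `(k, j)` summed in two ways: along `k + 2j = n` it gives the Taylor
components, along fixed `k` the Bessel functions. Absolute convergence comes from the geometric
bound on `X` and the factorial bound on `1/Γ`. -/
lemma hasSum_weightPairs (hμ : 0 < μ) (hq : 0 ≤ q) (hX : ConvCoeff q X) (t : ℝ) :
    HasSum (fun n => ∑ p ∈ weightPairs n,
      (-Complex.I * t / 2) ^ n * besselCoeff μ q p.1 p.2 * X p.1)
      (∑' k, (-Complex.I / 2) ^ k * X k * (bes μ q k t : ℂ)) := by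
  obtain ⟨M, R, hR, hM⟩ := hX.exists_norm_le
  obtain ⟨L, hL1, hL⟩ := exists_inv_Gamma_le hμ
  set F : ℕ × ℕ → ℂ := fun p =>
    (-Complex.I * t / 2) ^ (p.1 + 2 * p.2) * besselCoeff μ q p.1 p.2 * X p.1 with hF
  have hM0 : 0 ≤ M := by simpa using (norm_nonneg _).trans (hM 0)
  have hΓ : 0 < Real.Gamma μ := Real.Gamma_pos_of_pos hμ
  have hsum : Summable F := by
    refine .of_norm_bounded ((((Real.summable_pow_div_factorial (R * L * (|t| / 2))).mul_of_nonneg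
      (Real.summable_pow_div_factorial ((|t| / 2) ^ 2 * q * L)) (fun _ => by positivity)
      (fun _ => by positivity)).mul_left (M * (Real.Gamma μ)⁻¹))) ?_
    rintro ⟨k, j⟩
    have hGp : 0 < Real.Gamma (k + j + μ) := Real.Gamma_pos_of_pos (by positivity)
    have hn : ‖-Complex.I * t / 2‖ = |t| / 2 := by simp
    have hb : ‖(besselCoeff μ q k j : ℂ)‖ ≤ q ^ j / j ! * ((Real.Gamma μ)⁻¹ * (L ^ (k + j) / k !)) := by
      rw [Complex.norm_real, Real.norm_eq_abs, besselCoeff, abs_of_nonneg (by positivity)]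
      have h := hL (k + j)
      push_cast at h
      have hk : (k ! : ℝ) ≤ (k + j)! := by
        exact_mod_cast Nat.factorial_le (Nat.le_add_right k j)
      calc q ^ j / (j ! * Real.Gamma (k + j + μ)) = q ^ j / j ! * (Real.Gamma (k + j + μ))⁻¹ := by
            field_simp
        _ ≤ q ^ j / j ! * ((Real.Gamma μ)⁻¹ * (L ^ (k + j) / (k + j)!)) := by gcongr
        _ ≤ _ := by gcongr
    simp only [hF]
    rw [norm_mul, norm_mul, norm_pow, hn]
    calc _ ≤ (|t| / 2) ^ (k + 2 * j) * (q ^ j / j ! * ((Real.Gamma μ)⁻¹ * (L ^ (k + j) / k !))) *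
          (M * R ^ k) := by gcongr; exact hM k
      _ = _ := by rw [pow_add, pow_mul, pow_add]; ring
  have hfib : ∀ k, HasSum (fun j => F (k, j))
      ((-Complex.I / 2) ^ k * X k * (bes μ q k t : ℂ)) := by
    intro k
    have h := ((Complex.hasSum_ofReal.mpr
      (summable_regF (show 0 < k + μ by positivity) (-q * t ^ 2 / 4)).hasSum).mul_left
        ((-Complex.I / 2) ^ k * X k * (t : ℂ) ^ k))
    have hb : (-Complex.I / 2) ^ k * X k * (bes μ q k t : ℂ) = (-Complex.I / 2) ^ k * X k *
        (t : ℂ) ^ k * ((∑' j : ℕ, (-q * t ^ 2 / 4) ^ j / (j ! * Real.Gamma (j + (k + μ))) : ℝ) : ℂ) := by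
      rw [bes, regF, Complex.ofReal_mul, Complex.ofReal_pow]; ring
    rw [hb]
    convert! h using 2 with j
    · simp only [hF, besselCoeff]
      rw [show (k : ℝ) + j + μ = j + (k + μ) by ring]
      have e1 : (-Complex.I * t / 2) ^ (k + 2 * j) =
          (-Complex.I / 2) ^ k * (t : ℂ) ^ k * (-(t : ℂ) ^ 2 / 4) ^ j := by
        rw [pow_add, pow_mul, show -Complex.I * t / 2 = -Complex.I / 2 * t by ring, mul_pow]
        congr 2
        linear_combination ((t : ℂ) ^ 2 / 4) * Complex.I_sq
      rw [e1]
      push_cast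
      rw [show (-(q : ℂ) * t ^ 2 / 4) = q * (-(t : ℂ) ^ 2 / 4) by ring, mul_pow]
      ring
  have h1 := hsum.hasSum.prod_fiberwise hfib
  rw [h1.tsum_eq]
  have h2 := hsum.hasSum.tsum_fiberwise fun p => p.1 + 2 * p.2
  convert! h2 using 2 with n
  have hset : (fun p : ℕ × ℕ => p.1 + 2 * p.2) ⁻¹' {n} = ↑(weightPairs n) := by
    ext p; simp [mem_weightPairs]
  rw [hset, Finset.tsum_subtype']
  refine Finset.sum_congr rfl fun p hp => ?_
  simp only [hF]
  rw [mem_weightPairs.mp hp]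

lemma hasSum_shift_one {τ v : ℂ} (h : HasSum (fun k => X (k + 1) * τ ^ k) v) (h0 : X 0 = 0) :
    HasSum (fun k => X k * τ ^ k) (τ * v) := by
  rw [← hasSum_nat_add_iff' 1]
  simp only [Finset.range_one, Finset.sum_singleton, h0, zero_mul, sub_zero]
  convert! h.mul_left τ using 2 with k
  rw [pow_succ]; ring

/-- The values `s + i w`, `√+ - w`, `s - i w`, `√+ + w`. -/
noncomputable def poles (s S : ℂ) (w : ℝ) : Fin 4 → ℂ :=
  ![s + Complex.I * w, S - w, s - Complex.I * w, S + w]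

variable {s S : ℂ}

lemma lapKer_mul_series (hμ : 0 < μ) (hq : 0 ≤ q) (hs : 0 < s.re) (hSre : 0 < S.re)
    (hS : S ^ 2 = s ^ 2 + q) (hX : ConvCoeff q X) :
    IntegrableOn (fun t => lapKer μ s t *
      ∑' k, (-Complex.I / 2) ^ k * X k * (bes μ q k t : ℂ)) (Set.Ioi 0) ∧
    ∫ t in Set.Ioi (0 : ℝ), lapKer μ s t *
      ∑' k, (-Complex.I / 2) ^ k * X k * (bes μ q k t : ℂ) =
      lapBes μ q s 0 * ∑' k, X k * (-Complex.I / (s + S)) ^ k := by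
  have h := lapKer_mul_tsum (X := fun k => (-Complex.I / 2) ^ k * X k) hμ hq hs (by
    intro ϱ hϱ
    have hϱ0 : 0 < ϱ := lt_of_le_of_lt (by positivity) hϱ
    have h1 := hX (2 * ϱ)⁻¹ (by positivity) (by
      rw [inv_mul_lt_iff₀ (by positivity)]; linarith)
    convert! h1 using 2 with k
    simp only [norm_mul, norm_pow, norm_div, norm_neg, Complex.norm_I, Complex.norm_ofNat]
    rw [mul_inv, mul_pow]; ring)
  refine ⟨h.1, h.2.trans ?_⟩
  obtain ⟨h0, h1, -⟩ := half_add_identities hs hSre hS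
  rw [← tsum_mul_left]
  refine tsum_congr fun k => ?_
  rw [lapBes_eq hμ hq hs (sqrt_lt_norm_half_add hs hSre hS).le h0 h1 k]
  have : -Complex.I / (s + S) = -Complex.I / 2 * ((s + S) / 2)⁻¹ := by
    have : s + S ≠ 0 := fun h => h0 (by rw [h, zero_div])
    field_simp
  rw [this, mul_pow]; ring

lemma norm_mul_sqrt_lt (hs : 0 < s.re) (hSre : 0 < S.re) (hS : S ^ 2 = s ^ 2 + q)
    (l : ℕ) : ‖Complex.I ^ l * (-Complex.I / (s + S))‖ * √q < 1 := by
  have h := sqrt_lt_norm_half_add hs hSre hS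
  rw [norm_div, Complex.norm_ofNat] at h
  have h0 := Real.sqrt_nonneg q
  simp only [norm_mul, norm_pow, Complex.norm_I, one_pow, norm_div, norm_neg, one_mul]
  rw [one_div, inv_mul_lt_iff₀ (by linarith)]
  linarith

/-- Substituting `q = (S - s)(S + s)` cancels one factor `s + S`. -/
lemma gen_eq_poles_div (hs : 0 < s.re) (hSre : 0 < S.re) (hS : S ^ 2 = s ^ 2 + q) (l : Fin 4) :
    1 - 2 * w * (Complex.I ^ (l : ℕ) * (-Complex.I / (s + S))) +
      q * (Complex.I ^ (l : ℕ) * (-Complex.I / (s + S))) ^ 2 = poles s S w l / ((s + S) / 2) := by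
  obtain ⟨h0, -, -⟩ := half_add_identities hs hSre hS
  have h1 : s + S ≠ 0 := fun h => h0 (by rw [h, zero_div])
  have key : ∀ c N : ℂ, -2 * w * c * (s + S) + c ^ 2 * q + (s + S) ^ 2 = 2 * N * (s + S) →
      1 - 2 * w * (c / (s + S)) + q * (c / (s + S)) ^ 2 = N / ((s + S) / 2) := by
    intro c N h
    field_simp
    linear_combination h
  simp only [← mul_div_assoc (Complex.I ^ _)]
  fin_cases l <;> refine key _ _ ?_ <;> simp [poles, pow_succ]
  · linear_combination hS
  · linear_combination -hS
  · linear_combination hS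
  · linear_combination -hS

lemma poles_div_cpow (hs : 0 < s.re) (hSre : 0 < S.re) (hS : S ^ 2 = s ^ 2 + q)
    (hw : w ^ 2 ≤ q) (l : Fin 4) (c : ℂ) :
    (poles s S w l / ((s + S) / 2)) ^ c = poles s S w l ^ c / ((s + S) / 2) ^ c := by
  have h3 := div_half_add_cpow_of_sqrt hs hSre hS hw c
  have h1 := div_half_add_cpow_of_sqrt (w := -w) hs hSre hS (by rwa [neg_sq]) c
  rw [Complex.ofReal_neg, ← sub_eq_add_neg] at h1
  have h0 := div_half_add_cpow_of_re hs hSre (N := s + Complex.I * w) (by simpa) c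
  have h2 := div_half_add_cpow_of_re hs hSre (N := s - Complex.I * w) (by simpa) c
  fin_cases l
  · exact h0
  · exact h1
  · exact h2
  · exact h3

lemma hasSum_gegen_poles (hs : 0 < s.re) (hSre : 0 < S.re) (hS : S ^ 2 = s ^ 2 + q)
    (hw : w ^ 2 ≤ q) {χ : ℕ → ℂ} {a : Fin 4 → ℂ}
    (hχ : ∀ k, χ k = ∑ l, a l * (Complex.I ^ (l : ℕ)) ^ k) :
    HasSum (fun k => χ k * (gegen μ w q (k + 1) : ℂ) * (-Complex.I / (s + S)) ^ k)
      (∑ l, a l * (poles s S w l ^ (-μ : ℂ) / ((s + S) / 2) ^ (-μ : ℂ))) := by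
  have h : ∀ l : Fin 4, _ := fun l =>
    (hasSum_gegen (μ := μ) hw (norm_mul_sqrt_lt hs hSre hS l)).mul_left (a l)
  have h' := hasSum_sum (s := Finset.univ) fun l _ => h l
  simp only [gen_eq_poles_div hs hSre hS, poles_div_cpow hs hSre hS hw] at h'
  convert! h' using 2 with k
  rw [hχ, Finset.sum_mul, Finset.sum_mul]
  refine Finset.sum_congr rfl fun l _ => ?_
  rw [mul_pow]; ring

/-- At `w = 0` the expansion of `w^n` reduces to that of the constant `1`, so the Bessel series is
the constant `1/Γ(μ)` with transform `s^{-μ}`. Comparison with the generating function gives `σ^{-μ}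
= λ_0 (1 - qτ²)`, and `1 - qτ² = S/σ`. -/
lemma lapBes_zero (hμ : 0 < μ) (hq : 0 ≤ q) (hs : 0 < s.re) (hSre : 0 < S.re)
    (hS : S ^ 2 = s ^ 2 + q) :
    lapBes μ q s 0 = ((s + S) / 2) ^ (-μ : ℂ) * ((s + S) / 2) / S := by
  obtain ⟨hσ0, hσ1, hσ2⟩ := half_add_identities hs hSre hS
  have hw : (0 : ℝ) ^ 2 ≤ q := by simpa
  have hS0 : S ≠ 0 := by rintro rfl; simp at hSre
  have hs0 : s ≠ 0 := by rintro rfl; simp at hs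
  have hΓ : (Real.Gamma μ : ℂ) ≠ 0 := by exact_mod_cast (Real.Gamma_pos_of_pos hμ).ne'
  set X : ℕ → ℂ := fun k => (gegen μ 0 q (k + 1) : ℂ) - q * (gegen μ 0 q (k - 1) : ℂ) with hX
  have hg := convCoeff_gegen (μ := μ) hw
  have hXc : ConvCoeff q X := by
    refine hg.sub (ConvCoeff.bounded_mul (c := fun _ => (q : ℂ)) (M := |q|) ?_ (by simp))
    exact .of_succ (.of_succ (by simpa using hg))
  have hconst : ∀ t : ℝ, ∑' k, (-Complex.I / 2) ^ k * X k * (bes μ q k t : ℂ) =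
      (Real.Gamma μ : ℂ)⁻¹ := by
    intro t
    have h1 := hasSum_weightPairs hμ hq hXc t
    have h2 : ∀ n, ∑ p ∈ weightPairs n, (-Complex.I * t / 2) ^ n * besselCoeff μ q p.1 p.2 * X p.1 =
        if n = 0 then (Real.Gamma μ : ℂ)⁻¹ else 0 := by
      intro n
      have h3 := congrArg (fun r : ℝ => (r : ℂ)) (pow_eq_sum_gegen_sub hμ 0 q n)
      push_cast at h3
      simp only [mul_assoc, ← Finset.mul_sum, hX]
      rw [← inv_mul_eq_iff_eq_mul₀ hΓ] at h3
      rw [← h3]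
      split_ifs with hn
      · simp [hn]
      · simp [hn]
    simp only [h2] at h1
    exact h1.unique (by simpa using hasSum_ite_eq 0 (Real.Gamma μ : ℂ)⁻¹)
  have h1 := (lapKer_mul_series hμ hq hs hSre hS hXc).2
  simp only [hconst] at h1
  rw [integral_mul_const, integral_lapKer hμ hs] at h1
  have hone := hasSum_gegen_poles (μ := μ) (χ := fun _ => 1) (a := ![1, 0, 0, 0]) hs hSre hS hw
    (by intro k; simp [Fin.sum_univ_four])
  simp only [Fin.sum_univ_four, Matrix.cons_val, one_mul, zero_mul, add_zero, poles,
    Complex.ofReal_zero, mul_zero] at hone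
  set τ := -Complex.I / (s + S) with hτ
  have htwo : HasSum (fun k => (gegen μ 0 q (k - 1) : ℂ) * τ ^ k)
      (τ * (τ * (s ^ (-μ : ℂ) / ((s + S) / 2) ^ (-μ : ℂ)))) := by
    refine hasSum_shift_one (hasSum_shift_one ?_ (by simp)) (by simp)
    simpa using hone
  have hXsum : HasSum (fun k => X k * τ ^ k) (s ^ (-μ : ℂ) / ((s + S) / 2) ^ (-μ : ℂ) -
      q * (τ * (τ * (s ^ (-μ : ℂ) / ((s + S) / 2) ^ (-μ : ℂ))))) := by
    have h := hone.sub (htwo.mul_left (q : ℂ))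
    convert! h using 2 with k
    simp only [hX]; ring
  rw [hXsum.tsum_eq] at h1
  have hp : s ^ (-μ : ℂ) ≠ 0 := by simp [Complex.cpow_eq_zero_iff, hs0]
  have hp' : ((s + S) / 2) ^ (-μ : ℂ) ≠ 0 := by
    rw [Ne, Complex.cpow_eq_zero_iff]; exact fun h => hσ0 h.1
  have hsS : s + S ≠ 0 := fun h => hσ0 (by rw [h, zero_div])
  have hτ2 : 1 - q * τ ^ 2 = 2 * S / (s + S) := by
    rw [hτ, div_pow, neg_sq, Complex.I_sq]
    field_simp
    linear_combination (-1 : ℂ) * hS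
  generalize s ^ (-μ : ℂ) = P at hp h1
  generalize ((s + S) / 2) ^ (-μ : ℂ) = T at hp' h1 ⊢
  have h2 : T = lapBes μ q s 0 * (1 - q * τ ^ 2) := by
    field_simp at h1
    exact h1
  rw [hτ2] at h2
  rw [h2]
  field_simp

end series

/-! ### Period four and the discrete Fourier transform. -/

lemma I_zpow_congr {a b : ℤ} (h : (4 : ℤ) ∣ a - b) : Complex.I ^ a = Complex.I ^ b := by
  obtain ⟨c, hc⟩ := h
  rw [show a = b + 4 * c by linarith, zpow_add₀ Complex.I_ne_zero, zpow_mul,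
    show Complex.I ^ (4 : ℤ) = 1 by exact_mod_cast Complex.I_pow_four, one_zpow, mul_one]

lemma I_zpow_eval_congr (G : Polynomial ℤ) {a b : ℤ} (h : (4 : ℤ) ∣ a - b) :
    Complex.I ^ G.eval a = Complex.I ^ G.eval b :=
  I_zpow_congr (h.trans (Polynomial.sub_dvd_eval_sub a b G))

lemma norm_I_zpow (a : ℤ) : ‖Complex.I ^ a‖ = 1 := by
  rw [norm_zpow, Complex.norm_I, one_zpow]

/-- The finite Fourier expansion of a function of period `4`. -/
lemma eq_sum_vecMul_B {χ : ℕ → ℂ} (hχ : ∀ k, χ (k + 4) = χ k) {A : Fin 4 → ℂ}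
    (hA : ∀ l : Fin 4, A l = χ l) (k : ℕ) :
    χ k = ∑ l : Fin 4, Matrix.vecMul A B l / 4 * (Complex.I ^ (l : ℕ)) ^ k := by
  have hI : Complex.I ^ 2 = -1 := Complex.I_sq
  have hI4 : ∀ l : ℕ, (Complex.I ^ l) ^ 4 = 1 := fun l => by
    rw [← pow_mul, mul_comm, pow_mul, Complex.I_pow_four, one_pow]
  have h0 := hA 0
  have h1 := hA 1
  have h2 := hA 2
  have h3 := hA 3
  simp only [Fin.coe_ofNat_eq_mod, Nat.reduceMod] at h0 h1 h2 h3
  induction k using Nat.strong_induction_on with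
  | _ k ih =>
    match k with
    | 0 | 1 | 2 | 3 =>
      simp [Fin.sum_univ_four, Matrix.vecMul, dotProduct, B, h0, h1, h2, h3, pow_succ]
      ring_nf
      try simp only [hI]
      try ring_nf
    | k + 4 =>
      rw [hχ, ih k (by omega)]
      simp only [pow_add _ k 4, hI4, mul_one]

/-! ### The transformed plane wave and its Laplace transform. -/

section expansion

variable {m : ℕ} (G : Polynomial ℤ) (x y : RVec m)

/-- The coefficients of the scalar part of `e^{i(π/2)G(Γ)}` applied to a plane wave. -/
noncomputable def scalarCoeff (k : ℕ) : ℂ :=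
  Complex.I ^ G.eval (-(k : ℤ)) *
      gegen (m / 2) (inner ℝ x y) (‖x‖ ^ 2 * ‖y‖ ^ 2) (k + 1) -
    Complex.I ^ G.eval ((k : ℤ) + m - 2) * (((‖x‖ ^ 2 * ‖y‖ ^ 2 : ℝ) : ℂ) *
      gegen (m / 2) (inner ℝ x y) (‖x‖ ^ 2 * ‖y‖ ^ 2) (k - 1))

/-- The coefficients of the part of `e^{i(π/2)G(Γ)}` applied to a plane wave along `y x`. -/
noncomputable def bivectorCoeff (k : ℕ) : ℂ :=
  (Complex.I ^ G.eval (-(k : ℤ)) - Complex.I ^ G.eval ((k : ℤ) + m - 2)) *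
    gegen (m / 2) (inner ℝ x y) (‖x‖ ^ 2 * ‖y‖ ^ 2) k

lemma inner_sq_le : (inner ℝ x y : ℝ) ^ 2 ≤ ‖x‖ ^ 2 * ‖y‖ ^ 2 := by
  rw [← mul_pow]
  exact sq_le_sq.mpr ((abs_real_inner_le_norm x y).trans (le_abs_self _))

lemma convCoeff_scalarCoeff : ConvCoeff (‖x‖ ^ 2 * ‖y‖ ^ 2) (scalarCoeff G x y) := by
  have hg := convCoeff_gegen (μ := (m : ℝ) / 2) (inner_sq_le x y)
  refine (hg.bounded_mul (M := 1) fun k => (norm_I_zpow _).le).sub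
    (ConvCoeff.bounded_mul (M := 1) ?_ fun k => (norm_I_zpow _).le)
  exact ConvCoeff.bounded_mul (M := ‖((‖x‖ ^ 2 * ‖y‖ ^ 2 : ℝ) : ℂ)‖)
    (.of_succ (.of_succ (by simpa using hg))) fun _ => le_rfl

lemma convCoeff_bivectorCoeff : ConvCoeff (‖x‖ ^ 2 * ‖y‖ ^ 2) (bivectorCoeff G x y) := by
  have hg := convCoeff_gegen (μ := (m : ℝ) / 2) (inner_sq_le x y)
  have hX : ConvCoeff (‖x‖ ^ 2 * ‖y‖ ^ 2)
      fun k => (gegen (m / 2) (inner ℝ x y) (‖x‖ ^ 2 * ‖y‖ ^ 2) k : ℂ) := .of_succ hg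
  refine hX.bounded_mul (M := 1 + 1) fun k => ?_
  exact (norm_sub_le _ _).trans_eq (by rw [norm_I_zpow, norm_I_zpow])

lemma hasSum_expTerm_planeWave (hm : 1 ≤ m) (t : ℝ) (n : ℕ) :
    HasSum (fun j => expTerm G j (homPart n (planeWave t x)) y)
      ((Real.Gamma (m / 2) : ℂ) •
        ((∑ p ∈ weightPairs n, (-Complex.I * t / 2) ^ n *
            besselCoeff (m / 2) (‖x‖ ^ 2 * ‖y‖ ^ 2) p.1 p.2 * scalarCoeff G x y p.1) • (1 : CCl m) +
          (∑ p ∈ weightPairs n, (-Complex.I * t / 2) ^ n *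
            besselCoeff (m / 2) (‖x‖ ^ 2 * ‖y‖ ^ 2) p.1 p.2 * bivectorCoeff G x y p.1) •
            (vec y * vec x))) := by
  have hF : ∀ i : (ℕ × ℕ) × Bool, IsEigen
      (fun y => if i.2 then zonalMonogenic x i.1.1 i.1.2 y else zonalMonogenicConj x i.1.1 i.1.2 y)
      (if i.2 then -(i.1.1 : ℤ) else (i.1.1 : ℤ) + m - 2) := by
    rintro ⟨⟨k, j⟩, _ | _⟩
    · exact isEigen_zonalMonogenicConj x k j
    · exact isEigen_zonalMonogenic x k j
  rw [homPart_planeWave_eq_sum hm]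
  convert! hasSum_expTerm_sum hF G _ y using 1
  rw [Finset.sum_product, Finset.sum_smul, Finset.sum_smul, ← Finset.sum_add_distrib,
    Finset.smul_sum]
  refine Finset.sum_congr rfl fun p _ => ?_
  simp only [Fintype.univ_bool, Finset.mem_singleton, Bool.true_eq_false, not_false_eq_true,
    Finset.sum_insert, if_true, Finset.sum_singleton, Bool.false_eq_true, if_false, zonalMonogenic,
    zonalMonogenicConj, axial, besselCoeff, scalarCoeff, bivectorCoeff]
  push_cast
  module

lemma hasSum_expHom_planeWave (hm : 1 ≤ m) (t : ℝ) :
    HasSum (fun n => expHom G (homPart n (planeWave t x)) y)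
      ((Real.Gamma (m / 2) : ℂ) •
        ((∑' k, (-Complex.I / 2) ^ k * scalarCoeff G x y k *
            (bes (m / 2) (‖x‖ ^ 2 * ‖y‖ ^ 2) k t : ℂ)) • (1 : CCl m) +
          (∑' k, (-Complex.I / 2) ^ k * bivectorCoeff G x y k *
            (bes (m / 2) (‖x‖ ^ 2 * ‖y‖ ^ 2) k t : ℂ)) • (vec y * vec x))) := by
  have hμ : (0 : ℝ) < m / 2 := by positivity
  have hq : 0 ≤ ‖x‖ ^ 2 * ‖y‖ ^ 2 := by positivity
  have h1 := hasSum_weightPairs hμ hq (convCoeff_scalarCoeff G x y) t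
  have h2 := hasSum_weightPairs hμ hq (convCoeff_bivectorCoeff G x y) t
  have h := ((h1.smul_const (1 : CCl m)).add (h2.smul_const (vec y * vec x))).const_smul
    (Real.Gamma (m / 2) : ℂ)
  refine h.congr_fun ?_
  exact fun n => (hasSum_expTerm_planeWave G x y hm t n).tsum_eq

variable {s S : ℂ}

lemma I_zpow_eval_neg (k : ℕ) : Complex.I ^ G.eval (-(k : ℤ)) =
    ∑ l : Fin 4, Matrix.vecMul (A₁ G) B l / 4 * (Complex.I ^ (l : ℕ)) ^ k := by
  refine eq_sum_vecMul_B (χ := fun k : ℕ => Complex.I ^ G.eval (-(k : ℤ))) (fun k => ?_)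
    (fun l => ?_) k
  · exact I_zpow_eval_congr G ⟨-1, by push_cast; ring⟩
  · fin_cases l <;> simp [A₁]

/-- The exponent `k + m - 1` is `k + m - 2` moved by one: the conjugate family starts at `k = 1`,
which is why `A₂` starts at `G(m-1)`. -/
lemma I_zpow_eval_add (m k : ℕ) : Complex.I ^ G.eval ((k : ℤ) + m - 1) =
    ∑ l : Fin 4, Matrix.vecMul (A₂ m G) B l / 4 * (Complex.I ^ (l : ℕ)) ^ k := by
  refine eq_sum_vecMul_B (χ := fun k : ℕ => Complex.I ^ G.eval ((k : ℤ) + m - 1)) (fun k => ?_)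
    (fun l => ?_) k
  · exact I_zpow_eval_congr G ⟨1, by push_cast; ring⟩
  · fin_cases l <;> simp [A₂] <;> ring_nf

/-- The term `C_{k-2}` is reached by two index shifts, giving `τ²`. One of them is already built
into the exponent `k + m - 1`, so only one extra character factor `i^l` appears. -/
lemma hasSum_scalarCoeff (hs : 0 < s.re) (hSre : 0 < S.re)
    (hS : S ^ 2 = s ^ 2 + (‖x‖ ^ 2 * ‖y‖ ^ 2 : ℝ)) :
    HasSum (fun k => scalarCoeff G x y k * (-Complex.I / (s + S)) ^ k)
      (∑ l : Fin 4, (Matrix.vecMul (A₁ G) B l / 4 - (‖x‖ ^ 2 * ‖y‖ ^ 2 : ℝ) *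
          (-Complex.I / (s + S)) ^ 2 * (Matrix.vecMul (A₂ m G) B l / 4 * Complex.I ^ (l : ℕ))) *
        (poles s S (inner ℝ x y) l ^ (-(m / 2 : ℝ) : ℂ) / ((s + S) / 2) ^ (-(m / 2 : ℝ) : ℂ))) := by
  have hw := inner_sq_le x y
  have h1 := hasSum_gegen_poles (μ := m / 2) hs hSre hS hw (I_zpow_eval_neg G)
  have h2 := hasSum_gegen_poles (μ := m / 2) hs hSre hS hw
    (χ := fun k => Complex.I ^ G.eval (((k + 1 : ℕ) : ℤ) + m - 1))
    (a := fun l => Matrix.vecMul (A₂ m G) B l / 4 * Complex.I ^ (l : ℕ)) fun k => by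
      simp only [I_zpow_eval_add, pow_succ]
      exact Finset.sum_congr rfl fun l _ => by ring
  have h3 := hasSum_shift_one (X := fun k => Complex.I ^ G.eval ((k : ℤ) + m - 1) *
    (gegen (m / 2) (inner ℝ x y) (‖x‖ ^ 2 * ‖y‖ ^ 2) k : ℂ)) h2 (by simp)
  have h4 := hasSum_shift_one (X := fun k => Complex.I ^ G.eval ((k : ℤ) + m - 2) *
    (gegen (m / 2) (inner ℝ x y) (‖x‖ ^ 2 * ‖y‖ ^ 2) (k - 1) : ℂ)) (by
      convert! h3 using 4 with k
      · push_cast; ring_nf) (by simp)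
  convert! h1.sub (h4.mul_left ((‖x‖ ^ 2 * ‖y‖ ^ 2 : ℝ) : ℂ)) using 1
  · funext k
    rw [scalarCoeff]; ring
  · rw [Finset.mul_sum, Finset.mul_sum, Finset.mul_sum, ← Finset.sum_sub_distrib]
    exact Finset.sum_congr rfl fun l _ => by ring

lemma hasSum_bivectorCoeff (hs : 0 < s.re) (hSre : 0 < S.re)
    (hS : S ^ 2 = s ^ 2 + (‖x‖ ^ 2 * ‖y‖ ^ 2 : ℝ)) :
    HasSum (fun k => bivectorCoeff G x y k * (-Complex.I / (s + S)) ^ k)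
      (-Complex.I / (s + S) * ∑ l : Fin 4, (Matrix.vecMul (A₁ G) B l / 4 * Complex.I ^ (l : ℕ) -
          Matrix.vecMul (A₂ m G) B l / 4) *
        (poles s S (inner ℝ x y) l ^ (-(m / 2 : ℝ) : ℂ) / ((s + S) / 2) ^ (-(m / 2 : ℝ) : ℂ))) := by
  refine hasSum_shift_one ?_ (by simp [bivectorCoeff])
  refine hasSum_gegen_poles (μ := m / 2) hs hSre hS (inner_sq_le x y) fun k => ?_
  rw [show ((k + 1 : ℕ) : ℤ) + m - 2 = (k : ℤ) + m - 1 by push_cast; ring, I_zpow_eval_neg,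
    I_zpow_eval_add, ← Finset.sum_sub_distrib]
  exact Finset.sum_congr rfl fun l _ => by rw [pow_succ]; ring

/-- The signs `-i, 1, i, -1` in front of `yx` are `-i·i^l`, so the four entries can be treated
uniformly in `l`. -/
lemma C_eq (s : ℂ) (l : Fin 4) : C s x y l =
    (poles s (sqrtPlus s x y) (inner ℝ x y) l ^ (-(m / 2 : ℝ) : ℂ) / sqrtPlus s x y) •
      ((s + sqrtPlus s x y) • (1 : CCl m) -
        (Complex.I * Complex.I ^ (l : ℕ)) • (vec y * vec x)) := by
  have hm : ((m / 2 : ℝ) : ℂ) = (m : ℂ) / 2 := by push_cast; rfl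
  rw [hm, Complex.cpow_neg]
  fin_cases l
  · simp [C, f, poles, div_eq_mul_inv, mul_comm]
  · simp [C, fα, poles, div_eq_mul_inv, mul_comm]
  · simp [C, fβ, poles, div_eq_mul_inv, mul_comm]
  · simp [C, fγ, poles, div_eq_mul_inv, mul_comm]

instance (m : ℕ) : CompleteSpace (CCl m) :=
  have := (cclBasis m).finiteDimensional_of_finite
  FiniteDimensional.complete ℂ (CCl m)

end expansion

end CliffordFourier

/-! ### Assembly of the formula. -/

open CliffordFourier in
theorem mainTheorem4 (m : ℕ) (hm : 1 ≤ m) (G : Polynomial ℤ) (x y : RVec m) :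
    -- the kernel `e^{i(π/2)G(Γ_y)} e^{-it(x,y)}` is given by convergent series
    (∀ t : ℝ, (∀ k : ℕ, Summable fun n : ℕ => expTerm G n (homPart k (planeWave t x)) y) ∧
      Summable fun k : ℕ => expHom G (homPart k (planeWave t x)) y) ∧
    -- and its Laplace transform exists and has the stated form
    ∀ s : ℂ, 0 < s.re →
      MeasureTheory.IntegrableOn
        (fun t : ℝ => (Complex.exp (-s * (t : ℂ)) * ((t ^ ((m : ℝ) / 2 - 1) : ℝ) : ℂ)) •
          expAngular G (planeWave t x) y) (Set.Ioi 0) ∧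
      ∫ t in Set.Ioi (0 : ℝ), (Complex.exp (-s * (t : ℂ)) * ((t ^ ((m : ℝ) / 2 - 1) : ℝ) : ℂ)) •
          expAngular G (planeWave t x) y =
        ((Real.Gamma ((m : ℝ) / 2) : ℂ) / 8) •
          (ABC (A₁ G) (C s x y) +
            (Complex.I / (s + sqrtPlus s x y)) • (vec y * ABC (A₂ m G) (C s x y) * vec x)) := by
  refine ⟨fun t => ⟨fun k => (hasSum_expTerm_planeWave G x y hm t k).summable,
    (hasSum_expHom_planeWave G x y hm t).summable⟩, fun s hs => ?_⟩
  have hμ : (0 : ℝ) < m / 2 := by positivity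
  have hq : 0 ≤ ‖x‖ ^ 2 * ‖y‖ ^ 2 := by positivity
  have hSre : 0 < (sqrtPlus s x y).re := re_sqrt_pos hs hq
  have hS : sqrtPlus s x y ^ 2 = s ^ 2 + (‖x‖ ^ 2 * ‖y‖ ^ 2 : ℝ) := sqrt_sq s _
  obtain ⟨hσ0, -, -⟩ := half_add_identities hs hSre hS
  have hS0 : sqrtPlus s x y ≠ 0 := by intro h; simp [h] at hSre
  obtain ⟨i1, e1⟩ := lapKer_mul_series hμ hq hs hSre hS (convCoeff_scalarCoeff G x y)
  obtain ⟨i2, e2⟩ := lapKer_mul_series hμ hq hs hSre hS (convCoeff_bivectorCoeff G x y)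
  rw [(hasSum_scalarCoeff G x y hs hSre hS).tsum_eq, lapBes_zero hμ hq hs hSre hS] at e1
  rw [(hasSum_bivectorCoeff G x y hs hSre hS).tsum_eq, lapBes_zero hμ hq hs hSre hS] at e2
  have i1' := i1.smul_const (1 : CCl m)
  have i2' := i2.smul_const (vec y * vec x)
  have hfun : (fun t : ℝ => (Complex.exp (-s * (t : ℂ)) * ((t ^ ((m : ℝ) / 2 - 1) : ℝ) : ℂ)) •
      expAngular G (planeWave t x) y) = fun t => (Real.Gamma (m / 2) : ℂ) •
        ((lapKer (m / 2) s t * ∑' k, (-Complex.I / 2) ^ k * scalarCoeff G x y k *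
            (bes (m / 2) (‖x‖ ^ 2 * ‖y‖ ^ 2) k t : ℂ)) • (1 : CCl m) +
          (lapKer (m / 2) s t * ∑' k, (-Complex.I / 2) ^ k * bivectorCoeff G x y k *
            (bes (m / 2) (‖x‖ ^ 2 * ‖y‖ ^ 2) k t : ℂ)) • (vec y * vec x)) := by
    funext t
    rw [expAngular, (hasSum_expHom_planeWave G x y hm t).tsum_eq, lapKer, smul_comm, smul_add,
      smul_smul, smul_smul]
  rw [hfun]
  refine ⟨(i1'.add i2').smul (Real.Gamma (m / 2) : ℂ), ?_⟩
  rw [MeasureTheory.integral_smul, MeasureTheory.integral_add i1' i2', integral_smul_const,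
    integral_smul_const, e1, e2]
  have hT : ((s + sqrtPlus s x y) / 2) ^ (-(m / 2 : ℝ) : ℂ) ≠ 0 := by
    rw [Ne, Complex.cpow_eq_zero_iff]; exact fun h => hσ0 h.1
  have hsS : s + sqrtPlus s x y ≠ 0 := fun h => hσ0 (by rw [h, zero_div])
  simp only [ABC, C_eq, Finset.mul_sum, Finset.sum_mul, mul_smul_comm, smul_mul_assoc, mul_sub,
    sub_mul, mul_one, vec_mul_conj, Finset.sum_smul, Finset.smul_sum, ← Finset.sum_add_distrib]
  -- The identity holds for each `l` separately, so only the coefficients of `1` and `yx` remain to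
  -- be compared, where `σ^{-μ}` cancels.
  refine Finset.sum_congr rfl fun l _ => ?_
  set S := sqrtPlus s x y
  generalize ((s + S) / 2) ^ (-(m / 2 : ℝ) : ℂ) = T at hT ⊢
  generalize poles s S (inner ℝ x y) l ^ (-(m / 2 : ℝ) : ℂ) = P
  match_scalars
  · field_simp
    ring
  · field_simp
    ring
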